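/- **Setting.** Let $(X_k,Y_k)_{k\ge 1-n}$ be random variables with values in $\mathcal X\times\mathcal Y$ (the pairs with $k\le 0$ form a holdout set), and let $\mathcal F_t=\sigma((X_k,Y_k),\,1-n\le k\le t)$. For $t\ge1$ let $\mathrm{err}_t(y,C)\in[0,1]$ ($y\in\mathcal Y$, $C\subset\mathcal Y$) be an error function with $\mathrm{err}_t(y,\mathcal Y)=0$, $\mathrm{err}_t(y,\emptyset)=1$, and let $S_t(x,q)\in\{0,1\}$ and $\mathcal C_t(x,q)\subset\mathcal Y$ ($x\in\mathcal X$, $q\in\mathbb R$) be a selection rule and a prediction set rule, both (jointly) $\mathcal F_{t-1}$-measurable random functions, such that for some $B>0$ and all $t$, $x$ and $q\ge B$, $\mathcal C_t(x,q)=\mathcal Y$ or $S_t(x,q)=0$. Let $\alpha\in(0,1)$, $c>0$, $\beta\in(1/2,1)$, $\gamma_j=cj^{-\beta}$. The OnlineSCI thresholds are given by $q_1\in[0,B]$ and $$q_{t+1}=q_t+\gamma_{J(t)}\bigl(\mathrm{err}_t(Y_t,\mathcal C_t(X_t,q_t))\mathbf 1\{q_t\ge0\}+\mathbf 1\{q_t<0\}-\alpha\bigr)S_t(X_t,q_t),\qquad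 J(t)=1+\sum_{i=1}^{t-1}S_i(X_i,q_i).$$ The instantaneous error rate is $$\mathrm{IER}_t=\mathbb E[\mathrm{err}_t(Y_t,\mathcal C_t(X_t,q_t))\mid S_t(X_t,q_t)=1,\mathcal F_{t-1}]=\frac{\mathbb E[\mathrm{err}_t(Y_t,\mathcal C_t(X_t,q_t))\,S_t(X_t,q_t)\mid\mathcal F_{t-1}]}{\mathbb E[S_t(X_t,q_t)\mid\mathcal F_{t-1}]}\qquad(0/0=0).$$ **Assumptions.** Let $\Pi^0:[0,B]\to[0,1]$ be deterministic and nonincreasing, with $\Pi^0(q^0_\alpha)=\alpha$ for some $q^0_\alpha\in(0,B)$, continuously differentiable on some $[\ell,u]\subset(0,B)$ with $\ell<q^0_\alpha<u$, and $(\Pi^0)'(q^0_\alpha)<0$. Put $D_t=|\mathrm{IER}_t-\Pi^0(q_t)|\,\mathbf 1\{q_t\in[0,B]\}$. Let $\bar D_t\to0$ be a deterministic sequence, nonincreasing from some time on, and let $\eta_t\in(0,1]$ be nonincreasing with $\log(1/\eta_T)\le\log T$ for all large $T$, such that for some $C_1>0$ and all $t\ge1$, $$\mathbb P(D_t>C_1\bar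 D_t)\le\frac{6\eta_t}{\pi^2t^2}.$$ For deterministic integer sequences $\underline J,\bar J$ put $\omega(t)=1-\mathbb P(\underline J(t)\le J(t)\le\bar J(t))$. Consider one of the following two cases. (i) $\underline J(T)\sim rT$ for some $r>0$, $\bar J(T)=T$, $t(T)=\lfloor rT/2\rfloor$ and $\rho(T)=(\log T)^{1/2}T^{1/2-\beta}+T^{\beta-1}$. (ii) $\bar J$ is nondecreasing from some time on, $t(T)\to\infty$, $t(T)<T$ for large $T$, and with $\Delta(T)=\underline J(T+1)-\bar J(t(T))$ one has $\underline J(T+1)\sim\underline J(t(T))\sim\bar J(T+1)\sim\bar J(t(T))$, $\Delta(T)\sim\bar J(T+1)-\underline J(t(T))$, $\Delta(T)\to\infty$ and $\bar J(T)^\beta\ll\Delta(T)\ll\bar J(T)$; here $\rho(T)=(\log T)^{1/2}\Delta(T)^{1/2}\bar J(T)^{-\beta}+\Delta(T)^{-1}\bar J(T)^{\beta}$. **Conclusion.** (a) There are constants $T_0\ge1$ and $C_0>0$ such that for all $T\ge T_0$ $$\mathbb P\bigl(|\mathrm{IER}_T-\alpha|+|q_T-q^0_\alpha|\le C_0(\rho(T)+\bar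 D_{t(T)})\bigr)\ge1-3\eta'_T-\omega(t(T))-\omega(T+1),$$ where $\eta'_T=\eta_T$ in case (i) and $\eta'_T=\eta_{t(T)}$ in case (ii); in case (ii) one may also take $\eta'_T=\eta_T$ if $T=O(t(T))$. (b) Assume $\bar D_{t(T)}=O(\rho(T)+\bar D_T)$ and, in case (ii), $T=O(t(T))$. Then there are constants $T_0\ge1$ and $C_0>0$ such that for all $T\ge T_0$ $$\mathbb P\bigl(|\mathrm{IER}_T-\alpha|+|q_T-q^0_\alpha|\le C_0(\rho(T)+\bar D_T)\bigr)\ge1-3\eta_T-\omega(t(T))-\omega(T+1).$$ All constants $T_0,C_0$ may depend on everything except $T$. -/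

import Mathlib

open MeasureTheory Filter Asymptotics

namespace OnlineSCI

/-- A data stream `(X_k, Y_k)`: the pairs with `1 - n ≤ k ≤ 0` form the holdout set of size `n`,
the pairs with `k ≥ 1` arrive one after the other. The indices `k < 1 - n` are never used. -/
structure DataStream (Ω 𝒳 𝒴 : Type*) [MeasurableSpace Ω] [MeasurableSpace 𝒳]
    [MeasurableSpace 𝒴] where
  n : ℕ
  X : ℤ → Ω → 𝒳
  Y : ℤ → Ω → 𝒴
  measurable_X : ∀ k, 1 - (n : ℤ) ≤ k → Measurable (X k)
  measurable_Y : ∀ k, 1 - (n : ℤ) ≤ k → Measurable (Y k)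

/-- The σ-algebra `𝓕_t` generated by the holdout set and by `(X_k, Y_k)`, `1 ≤ k ≤ t`. -/
abbrev DataStream.past {Ω 𝒳 𝒴 : Type*} [MeasurableSpace Ω] [MeasurableSpace 𝒳]
    [MeasurableSpace 𝒴] (P : DataStream Ω 𝒳 𝒴) (t : ℤ) : MeasurableSpace Ω :=
  ⨆ k ∈ Set.Icc (1 - (P.n : ℤ)) t,
    MeasurableSpace.comap (fun ω => (P.X k ω, P.Y k ω)) inferInstance

/-- Error functions, selection rules and prediction set rules, at the times `t ≥ 1`.
The rules at time `t` are `𝓕_{t-1}`-measurable random functions of `(x, q)`; the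
measurability of the set-valued rule is that of the errors it makes. -/
structure Rules {Ω 𝒳 𝒴 : Type*} [MeasurableSpace Ω] [MeasurableSpace 𝒳] [MeasurableSpace 𝒴]
    (P : DataStream Ω 𝒳 𝒴) where
  /-- `err_t(y, C)` -/
  err : ℕ → 𝒴 → Set 𝒴 → ℝ
  /-- `S_t(x, q)` -/
  sel : ℕ → Ω → 𝒳 → ℝ → ℕ
  /-- `𝒞_t(x, q)` -/
  predSet : ℕ → Ω → 𝒳 → ℝ → Set 𝒴
  B : ℝ
  B_pos : 0 < B
  err_mem : ∀ t, 1 ≤ t → ∀ y C, err t y C ∈ Set.Icc (0 : ℝ) 1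
  err_univ : ∀ t, 1 ≤ t → ∀ y, err t y Set.univ = 0
  err_empty : ∀ t, 1 ≤ t → ∀ y, err t y ∅ = 1
  sel_zero_or_one : ∀ t, 1 ≤ t → ∀ ω x q, sel t ω x q = 0 ∨ sel t ω x q = 1
  above_B : ∀ t, 1 ≤ t → ∀ ω x q, B ≤ q → predSet t ω x q = Set.univ ∨ sel t ω x q = 0
  measurable_sel : ∀ t : ℕ, 1 ≤ t →
    Measurable[(P.past ((t : ℤ) - 1)).prod (inferInstance : MeasurableSpace (𝒳 × ℝ))]
      (fun z : Ω × 𝒳 × ℝ => sel t z.1 z.2.1 z.2.2)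
  measurable_err : ∀ t : ℕ, 1 ≤ t →
    Measurable[(P.past ((t : ℤ) - 1)).prod (inferInstance : MeasurableSpace (𝒳 × ℝ × 𝒴))]
      (fun z : Ω × 𝒳 × ℝ × 𝒴 => err t z.2.2.2 (predSet t z.1 z.2.1 z.2.2.1))

section Procedure

variable {Ω 𝒳 𝒴 : Type*} [MeasurableSpace Ω] [MeasurableSpace 𝒳] [MeasurableSpace 𝒴]
  {P : DataStream Ω 𝒳 𝒴}

/-- `react_t(y, C, q) = err_t(y, C) 1{q ≥ 0} + 1{q < 0}`. -/
noncomputable def react (R : Rules P) (t : ℕ) (y : 𝒴) (C : Set 𝒴) (q : ℝ) : ℝ :=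
  if 0 ≤ q then R.err t y C else 1

/-- The pair `(q_{t+1}, J(t+1))` of threshold and selection number after `t` steps. -/
noncomputable def state (R : Rules P) (γ : ℕ → ℝ) (α q₁ : ℝ) : ℕ → Ω → ℝ × ℕ
  | 0, _ => (q₁, 1)
  | t + 1, ω =>
    let q := (state R γ α q₁ t ω).1
    let j := (state R γ α q₁ t ω).2
    let x := P.X ((t + 1 : ℕ) : ℤ) ω
    let y := P.Y ((t + 1 : ℕ) : ℤ) ω
    (q + γ j * (react R (t + 1) y (R.predSet (t + 1) ω x q) q - α) * R.sel (t + 1) ω x q,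
      j + R.sel (t + 1) ω x q)

/-- The OnlineSCI threshold `q_t`, for `t ≥ 1`. -/
noncomputable def threshold (R : Rules P) (γ : ℕ → ℝ) (α q₁ : ℝ) (t : ℕ) (ω : Ω) : ℝ :=
  (state R γ α q₁ (t - 1) ω).1

/-- `J(t) = ∑_{1 ≤ i < t} S_i(X_i, q_i) + 1`. -/
noncomputable def selNumber (R : Rules P) (γ : ℕ → ℝ) (α q₁ : ℝ) (t : ℕ) (ω : Ω) : ℕ :=
  ∑ i ∈ Finset.Ico 1 t, R.sel i ω (P.X i ω) (threshold R γ α q₁ i ω) + 1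

theorem state_snd (R : Rules P) (γ : ℕ → ℝ) (α q₁ : ℝ) (t : ℕ) (ω : Ω) :
    (state R γ α q₁ t ω).2 = selNumber R γ α q₁ (t + 1) ω := by
  induction t with
  | zero => simp [state, selNumber]
  | succ t ih =>
    rw [selNumber, Finset.sum_Ico_succ_top (by omega)]
    rw [selNumber] at ih
    simp only [state, ih, threshold, Nat.add_sub_cancel]
    ring

theorem threshold_one (R : Rules P) (γ : ℕ → ℝ) (α q₁ : ℝ) (ω : Ω) :
    threshold R γ α q₁ 1 ω = q₁ := rfl

/-- The defining recursion of OnlineSCI. -/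
theorem threshold_succ (R : Rules P) (γ : ℕ → ℝ) (α q₁ : ℝ) (t : ℕ) (ht : 1 ≤ t) (ω : Ω) :
    threshold R γ α q₁ (t + 1) ω = threshold R γ α q₁ t ω
      + γ (selNumber R γ α q₁ t ω)
        * (react R t (P.Y t ω) (R.predSet t ω (P.X t ω) (threshold R γ α q₁ t ω))
            (threshold R γ α q₁ t ω) - α)
        * R.sel t ω (P.X t ω) (threshold R γ α q₁ t ω) := by
  obtain ⟨s, rfl⟩ : ∃ s, t = s + 1 := ⟨t - 1, by omega⟩
  rw [← state_snd]
  rfl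

/-- `Π_{𝒞_t,S_t}(q) = E[err_t(Y_t, 𝒞_t(X_t, q)) | S_t(X_t, q) = 1, 𝓕_{t-1}]`, for a threshold `q`
that is a constant or, more generally, an `𝓕_{t-1}`-measurable random variable. It is `0` where
the conditional probability of selection vanishes. -/
noncomputable def condError (μ : Measure Ω) (R : Rules P) (t : ℕ) (q : Ω → ℝ) (ω : Ω) : ℝ :=
  (μ[fun ω' => R.err t (P.Y t ω') (R.predSet t ω' (P.X t ω') (q ω'))
      * (R.sel t ω' (P.X t ω') (q ω') : ℝ) | P.past ((t : ℤ) - 1)]) ω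
    / (μ[fun ω' => (R.sel t ω' (P.X t ω') (q ω') : ℝ) | P.past ((t : ℤ) - 1)]) ω

/-- The instantaneous error rate of OnlineSCI at time `t`. -/
noncomputable def ier (μ : Measure Ω) (R : Rules P) (γ : ℕ → ℝ) (α q₁ : ℝ) (t : ℕ) (ω : Ω) : ℝ :=
  condError μ R t (threshold R γ α q₁ t) ω

open Classical in
/-- `D_t = |Π_{𝒞_t,S_t}(q_t) - Π⁰(q_t)| 1{q_t ∈ [0, B]}`. -/
noncomputable def benchDist (μ : Measure Ω) (R : Rules P) (γ : ℕ → ℝ) (α q₁ : ℝ) (Pi0 : ℝ → ℝ)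
    (t : ℕ) (ω : Ω) : ℝ :=
  if threshold R γ α q₁ t ω ∈ Set.Icc 0 R.B then
    |condError μ R t (threshold R γ α q₁ t) ω - Pi0 (threshold R γ α q₁ t ω)|
  else 0

/-- `ω(t) = 1 - P(Jlow(t) ≤ J(t) ≤ Jup(t))`. -/
noncomputable def bracketFailure (μ : Measure Ω) (R : Rules P) (γ : ℕ → ℝ) (α q₁ : ℝ)
    (Jlow Jup : ℕ → ℤ) (t : ℕ) : ℝ :=
  1 - μ.real {ω | Jlow t ≤ (selNumber R γ α q₁ t ω : ℤ) ∧ (selNumber R γ α q₁ t ω : ℤ) ≤ Jup t}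

/-- There are constants `T₀ ≥ 1` and `C₀ > 0` such that for all `T ≥ T₀`, with probability at least
`1 - 3 η_T - ω(t(T)) - ω(T+1)`, one has `|IER_T - α| + |q_T - q₀| ≤ C₀ rate(T)`. -/
def HasRate (μ : Measure Ω) (R : Rules P) (γ : ℕ → ℝ) (α q₁ q₀ : ℝ) (Jlow Jup : ℕ → ℤ)
    (tT : ℕ → ℕ) (η rate : ℕ → ℝ) : Prop :=
  ∃ T₀ : ℕ, ∃ C₀ : ℝ, 1 ≤ T₀ ∧ 0 < C₀ ∧ ∀ T : ℕ, T₀ ≤ T →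
    1 - 3 * η T - bracketFailure μ R γ α q₁ Jlow Jup (tT T)
        - bracketFailure μ R γ α q₁ Jlow Jup (T + 1)
      ≤ μ.real {ω | |ier μ R γ α q₁ T ω - α| + |threshold R γ α q₁ T ω - q₀| ≤ C₀ * rate T}

end Procedure

/-- The regularity assumption on the benchmark function `Π⁰ : [0, B] → [0, 1]` with
`Π⁰(q₀) = α`. -/
structure IsBenchmark (B α q₀ : ℝ) (Pi0 : ℝ → ℝ) : Prop where
  mem_unit : ∀ q ∈ Set.Icc 0 B, Pi0 q ∈ Set.Icc (0 : ℝ) 1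
  q₀_mem : q₀ ∈ Set.Ioo 0 B
  value : Pi0 q₀ = α
  antitone : AntitoneOn Pi0 (Set.Icc 0 B)
  smooth : ∃ l u : ℝ, 0 < l ∧ l < q₀ ∧ q₀ < u ∧ u < B ∧ ContDiffOn ℝ 1 Pi0 (Set.Icc l u)
  deriv_neg : deriv Pi0 q₀ < 0

/-- The step sequence `γ_j = c j^{-β}`. -/
noncomputable def step (c β : ℝ) (j : ℕ) : ℝ := c * (j : ℝ) ^ (-β)

/-- `(log T)^{1/2} T^{1/2-β} + T^{β-1}`. -/
noncomputable def rhoLinear (β : ℝ) (T : ℕ) : ℝ :=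
  Real.sqrt (Real.log T) * (T : ℝ) ^ (1 / 2 - β) + (T : ℝ) ^ (β - 1)

/-- `Δ(T) = Jlow(T+1) - Jup(t(T))`. -/
def gap (Jlow Jup : ℕ → ℤ) (tT : ℕ → ℕ) (T : ℕ) : ℝ := ((Jlow (T + 1) - Jup (tT T) : ℤ) : ℝ)

/-- `(log T)^{1/2} Δ(T)^{1/2} Jup(T)^{-β} + Δ(T)^{-1} Jup(T)^β`. -/
noncomputable def rhoConc (β : ℝ) (Jlow Jup : ℕ → ℤ) (tT : ℕ → ℕ) (T : ℕ) : ℝ :=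
  Real.sqrt (Real.log T) * Real.sqrt (gap Jlow Jup tT T) * (Jup T : ℝ) ^ (-β)
    + (gap Jlow Jup tT T)⁻¹ * (Jup T : ℝ) ^ β

/-- The regime of concentration of the selection number. -/
structure IsConcRegime (β : ℝ) (Jlow Jup : ℕ → ℤ) (tT : ℕ → ℕ) : Prop where
  mono_up : ∀ᶠ t in atTop, Jup t ≤ Jup (t + 1)
  time_lt : ∀ᶠ T in atTop, tT T < T
  time_tendsto : Tendsto tT atTop atTop
  low_low : (fun T : ℕ => (Jlow (T + 1) : ℝ)) ~[atTop] (fun T => (Jlow (tT T) : ℝ))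
  low_up : (fun T : ℕ => (Jlow (tT T) : ℝ)) ~[atTop] (fun T => (Jup (T + 1) : ℝ))
  up_up : (fun T : ℕ => (Jup (T + 1) : ℝ)) ~[atTop] (fun T => (Jup (tT T) : ℝ))
  gap_equiv : gap Jlow Jup tT ~[atTop] (fun T => (Jup (T + 1) : ℝ) - (Jlow (tT T) : ℝ))
  gap_tendsto : Tendsto (gap Jlow Jup tT) atTop atTop
  pow_lt_gap : (fun T : ℕ => (Jup T : ℝ) ^ β) =o[atTop] gap Jlow Jup tT
  gap_lt_up : gap Jlow Jup tT =o[atTop] (fun T : ℕ => (Jup T : ℝ))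

end OnlineSCI

/-!
Inside `[0, B]` the recursion for the threshold is a stochastic approximation scheme with mean
increment `γ_{J(t)} (IER_t - α)` on the steps where a selection is made. Up to the benchmark error,
`IER_t` is `Π⁰(q_t)`, which crosses the level `α` linearly at `q₀`, and outside `[0, B]` the update
points back towards the interval. While `q_t` is farther than `ε` from `q₀`, each selection
therefore drives it back by at least a multiple of `γ_{J(t)} ε`, apart from martingale noise.

Follow the threshold over a window `[t₀, T]` up to its last visit to the `ε`-neighbourhood of `q₀`.
After that visit the drift only helps, so the final distance is at most `ε`, one step and the noise
accumulated since; without any visit the total drift over the window would exceed the largest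
possible initial distance. The noise is controlled by an exponential supermartingale, whose
variance proxy is the sum of the squared steps over the selections of the window, and a union
bound over the possible last visits costs the factor `log T`. The brackets on the selection number
turn the random sums of steps into the deterministic rates.
-/

namespace OnlineSCI

section Excursion

variable {x w ξ : ℕ → ℝ} {s T : ℕ} {ε b a θ : ℝ}

theorem le_add_sum_sub_of_drift (hsT : s ≤ T)
    (hdrift : ∀ t, s ≤ t → t < T → x (t + 1) ≤ x t + ξ t - θ * w t) :
    x T ≤ x s + ∑ t ∈ Finset.Ico s T, ξ t - θ * ∑ t ∈ Finset.Ico s T, w t := by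
  induction T, hsT using Nat.le_induction with
  | base => simp
  | succ T hsT ih =>
    rw [Finset.sum_Ico_succ_top hsT, Finset.sum_Ico_succ_top hsT]
    linarith [ih fun t hst htT => hdrift t hst (htT.trans T.lt_succ_self),
      hdrift T hsT T.lt_succ_self]

theorem exists_last_le_or_forall_lt (hsT : s ≤ T) :
    (∃ τ, s ≤ τ ∧ τ ≤ T ∧ x τ ≤ ε ∧ ∀ t, τ < t → t ≤ T → ε < x t) ∨
      ∀ t, s ≤ t → t ≤ T → ε < x t := by
  induction T, hsT using Nat.le_induction with
  | base =>
    rcases le_or_gt (x s) ε with h | h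
    · exact .inl ⟨s, le_rfl, le_rfl, h, fun t h₁ h₂ => by omega⟩
    · exact .inr fun t h₁ h₂ => by rwa [le_antisymm h₂ h₁]
  | succ T hsT ih =>
    rcases le_or_gt (x (T + 1)) ε with h | h
    · exact .inl ⟨T + 1, by omega, le_rfl, h, fun t h₁ h₂ => by omega⟩
    · have extend {τ : ℕ} (hτ : ∀ t, τ ≤ t → t ≤ T → ε < x t) (t : ℕ) (h₁ : τ ≤ t)
          (h₂ : t ≤ T + 1) : ε < x t := by
        rcases Nat.le_succ_iff.mp h₂ with h₂ | rfl
        exacts [hτ t h₁ h₂, h]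
      rcases ih with ⟨τ, hsτ, hτT, hτ, hlast⟩ | hall
      · exact .inl ⟨τ, hsτ, hτT.trans T.le_succ, hτ, extend hlast⟩
      · exact .inr (extend hall)

/- After its last visit below `ε` the sequence gains at most one step and the noise; if there is no
such visit, the accumulated drift exceeds the initial value. -/
theorem le_of_drift (hsT : s ≤ T) (hε : 0 ≤ ε) (hb : 0 ≤ b) (hw : ∀ t, 0 ≤ w t) (hθ : 0 ≤ θ)
    (hstep : ∀ t, s ≤ t → t < T → x (t + 1) ≤ x t + b)
    (hdrift : ∀ t, s ≤ t → t < T → ε < x t → x (t + 1) ≤ x t + ξ t - θ * w t)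
    (hξ : ∀ r, s ≤ r → r ≤ T → ∑ t ∈ Finset.Ico r T, ξ t ≤ a)
    (hpush : x s ≤ θ * ∑ t ∈ Finset.Ico s T, w t) :
    x T ≤ ε + b + a := by
  have ha : 0 ≤ a := by simpa using hξ T hsT le_rfl
  rcases exists_last_le_or_forall_lt (x := x) (ε := ε) hsT with
    ⟨τ, hsτ, hτT, hτ, hlast⟩ | hall
  · rcases hτT.eq_or_lt with rfl | hlt
    · linarith
    · have hend := le_add_sum_sub_of_drift (x := x) (w := w) (ξ := ξ) (θ := θ) hlt fun t hτt htT =>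
        hdrift t (by omega) htT (hlast t hτt htT.le)
      have hnonneg : 0 ≤ θ * ∑ t ∈ Finset.Ico (τ + 1) T, w t :=
        mul_nonneg hθ (Finset.sum_nonneg fun t _ => hw t)
      linarith [hξ (τ + 1) (by omega) hlt, hstep τ hsτ hlt]
  · have hend := le_add_sum_sub_of_drift hsT fun t hst htT =>
      hdrift t hst htT (hall t hst htT.le)
    linarith [hξ s le_rfl hsT]

end Excursion

section CondExp

variable {Ω : Type*} {m m0 : MeasurableSpace Ω} {μ : Measure Ω} {f h p w : Ω → ℝ}

theorem condExp_div_condExp_mem_Icc (hf : Integrable f μ) (hh : Integrable h μ)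
    (hf_nonneg : ∀ ω, 0 ≤ f ω) (hfh : ∀ ω, f ω ≤ h ω) :
    ∀ᵐ ω ∂μ, (μ[f | m]) ω / (μ[h | m]) ω ∈ Set.Icc (0 : ℝ) 1 := by
  filter_upwards [condExp_nonneg (m := m) (ae_of_all μ hf_nonneg),
    condExp_mono (m := m) hf hh (ae_of_all μ hfh)] with ω hω₀ hω
  exact ⟨div_nonneg hω₀ (hω₀.trans hω), div_le_one_of_le₀ hω (hω₀.trans hω)⟩

theorem condExp_div_condExp_mul_cancel (hf : Integrable f μ) (hh : Integrable h μ)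
    (hf_nonneg : ∀ ω, 0 ≤ f ω) (hfh : ∀ ω, f ω ≤ h ω) :
    ∀ᵐ ω ∂μ, (μ[f | m]) ω / (μ[h | m]) ω * (μ[h | m]) ω = (μ[f | m]) ω := by
  filter_upwards [condExp_nonneg (m := m) (ae_of_all μ hf_nonneg),
    condExp_mono (m := m) hf hh (ae_of_all μ hfh)] with ω hω₀ hω
  refine div_mul_cancel_of_imp fun hzero => le_antisymm (hω.trans_eq hzero) hω₀

theorem condExp_sub_mul_eq_zero [IsFiniteMeasure μ] (hm : m ≤ m0) (hf : Integrable f μ)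
    (hh : Integrable h μ) (hp : Measurable[m] p) {C : ℝ} (hC : ∀ ω, |p ω| ≤ C)
    (hcond : μ[f | m] =ᵐ[μ] p * μ[h | m]) :
    μ[f - p * h | m] =ᵐ[μ] 0 := by
  have hph : Integrable (p * h) μ :=
    hh.bdd_mul (hp.mono hm le_rfl).aestronglyMeasurable (ae_of_all _ hC)
  filter_upwards [condExp_sub hf hph m, hcond,
    condExp_mul_of_stronglyMeasurable_left hp.stronglyMeasurable hph hh] with ω hsub hω hpull
  rw [hsub, Pi.sub_apply, hω, hpull, sub_self, Pi.zero_apply]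

theorem condExp_mul_eq_zero [IsFiniteMeasure μ] (hm : m ≤ m0) (hf : Integrable f μ)
    (hw : Measurable[m] w) {C : ℝ} (hC : ∀ ω, |w ω| ≤ C) (hcond : μ[f | m] =ᵐ[μ] 0) :
    μ[w * f | m] =ᵐ[μ] 0 := by
  have hwf : Integrable (w * f) μ :=
    hf.bdd_mul (hw.mono hm le_rfl).aestronglyMeasurable (ae_of_all _ hC)
  filter_upwards [condExp_mul_of_stronglyMeasurable_left hw.stronglyMeasurable hwf hf, hcond]
    with ω hpull hω
  rw [hpull, Pi.mul_apply, hω, Pi.zero_apply, mul_zero]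

theorem integral_mul_eq_zero_of_condExp_eq_zero [IsFiniteMeasure μ] (hm : m ≤ m0)
    (hf : Integrable f μ) (hw : Measurable[m] w) {C : ℝ} (hC : ∀ ω, |w ω| ≤ C)
    (hcond : μ[f | m] =ᵐ[μ] 0) :
    ∫ ω, w ω * f ω ∂μ = 0 :=
  calc ∫ ω, w ω * f ω ∂μ = ∫ ω, (μ[w * f | m]) ω ∂μ := (integral_condExp hm).symm
    _ = ∫ _, 0 ∂μ := integral_congr_ae (condExp_mul_eq_zero hm hf hw hC hcond)
    _ = 0 := integral_zero _ _

end CondExp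

section Deviation

theorem exp_le_add_exp_sq (x : ℝ) : Real.exp x ≤ x + Real.exp (x ^ 2) := by
  have hsq := Real.add_one_le_exp (x ^ 2)
  rcases le_or_gt |x| 1 with hx | hx
  · linarith [(abs_le.mp (Real.abs_exp_sub_one_sub_id_le hx)).2]
  · rcases lt_abs.mp hx with h | h
    · linarith [Real.exp_le_exp.mpr (show x ≤ x ^ 2 by nlinarith)]
    · nlinarith [Real.exp_le_one_iff.mpr (show x ≤ 0 by linarith)]

/- At an unselected time (`s = 0`) the increment vanishes, so the factor of `x` may be taken as if
the time were selected; this makes it predictable, which `s` is not. -/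
theorem exp_sub_sq_mul_le {x g s : ℝ} (hs : s = 0 ∨ s = 1) (hx : |x| ≤ |g| * s) :
    Real.exp (x - g ^ 2 * s) ≤ 1 + x * Real.exp (-g ^ 2) := by
  rcases hs with rfl | rfl
  · simp [abs_nonpos_iff.mp (hx.trans_eq (mul_zero _))]
  · rw [mul_one] at hx ⊢
    calc Real.exp (x - g ^ 2) = Real.exp x * Real.exp (-g ^ 2) := by
          rw [sub_eq_add_neg, Real.exp_add]
      _ ≤ (x + Real.exp (g ^ 2)) * Real.exp (-g ^ 2) := by
          gcongr
          linarith [exp_le_add_exp_sq x, Real.exp_le_exp.mpr (sq_le_sq.mpr hx)]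
      _ = 1 + x * Real.exp (-g ^ 2) := by
          rw [add_mul, ← Real.exp_add, add_neg_cancel, Real.exp_zero, add_comm]

variable {Ω : Type*} {m0 : MeasurableSpace Ω} {μ : Measure Ω}

/-- Centered increments `x t`, `t ≥ a`, that vanish outside the selected times (`s t = 1`) and are
dominated by a bounded predictable envelope `g`. -/
structure IsSelectedNoise (μ : Measure Ω) (ℱ : Filtration ℕ m0) (x g s : ℕ → Ω → ℝ) (a : ℕ)
    (K : ℝ) : Prop where
  measurable_noise : ∀ t, a ≤ t → Measurable[ℱ (t + 1)] (x t)
  measurable_envelope : ∀ t, a ≤ t → Measurable[ℱ t] (g t)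
  measurable_sel : ∀ t, a ≤ t → Measurable[ℱ (t + 1)] (s t)
  sel_eq : ∀ t, a ≤ t → ∀ ω, s t ω = 0 ∨ s t ω = 1
  abs_noise_le : ∀ t, a ≤ t → ∀ ω, |x t ω| ≤ |g t ω| * s t ω
  abs_envelope_le : ∀ t, a ≤ t → ∀ ω, |g t ω| ≤ K
  condExp_eq_zero : ∀ t, a ≤ t → μ[x t | ℱ t] =ᵐ[μ] 0

/-- The exponential of the noise accumulated on `[a, n)`, compensated by its variance proxy: the
supermartingale behind the deviation inequality. -/
noncomputable def expNoise (x g s : ℕ → Ω → ℝ) (a n : ℕ) (ω : Ω) : ℝ :=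
  Real.exp (∑ t ∈ Finset.Ico a n, (x t ω - g t ω ^ 2 * s t ω))

namespace IsSelectedNoise

variable {ℱ : Filtration ℕ m0} {x g s : ℕ → Ω → ℝ} {a n : ℕ} {K : ℝ}

theorem mono_start (h : IsSelectedNoise μ ℱ x g s a K) {b : ℕ} (hab : a ≤ b) :
    IsSelectedNoise μ ℱ x g s b K where
  measurable_noise t ht := h.measurable_noise t (hab.trans ht)
  measurable_envelope t ht := h.measurable_envelope t (hab.trans ht)
  measurable_sel t ht := h.measurable_sel t (hab.trans ht)
  sel_eq t ht := h.sel_eq t (hab.trans ht)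
  abs_noise_le t ht := h.abs_noise_le t (hab.trans ht)
  abs_envelope_le t ht := h.abs_envelope_le t (hab.trans ht)
  condExp_eq_zero t ht := h.condExp_eq_zero t (hab.trans ht)

theorem const_mul (h : IsSelectedNoise μ ℱ x g s a K) (lam : ℝ) :
    IsSelectedNoise μ ℱ (fun t ω => lam * x t ω) (fun t ω => lam * g t ω) s a (|lam| * K) where
  measurable_noise t ht := (h.measurable_noise t ht).const_mul lam
  measurable_envelope t ht := (h.measurable_envelope t ht).const_mul lam
  measurable_sel := h.measurable_sel
  sel_eq := h.sel_eq
  abs_noise_le t ht ω := by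
    rw [abs_mul, abs_mul, mul_assoc]
    gcongr
    exact h.abs_noise_le t ht ω
  abs_envelope_le t ht ω := by
    rw [abs_mul]
    gcongr
    exact h.abs_envelope_le t ht ω
  condExp_eq_zero t ht := by
    filter_upwards [condExp_smul (μ := μ) lam (x t) (ℱ t), h.condExp_eq_zero t ht] with ω hω hω₀
    exact hω.trans (by rw [Pi.smul_apply, hω₀, Pi.zero_apply, smul_zero])

theorem abs_noise_le_bound (h : IsSelectedNoise μ ℱ x g s a K) {t : ℕ} (ht : a ≤ t) (ω : Ω) :
    |x t ω| ≤ K := by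
  have hx := h.abs_noise_le t ht ω
  have hg := h.abs_envelope_le t ht ω
  rcases h.sel_eq t ht ω with hs | hs <;> rw [hs] at hx <;> linarith [abs_nonneg (g t ω)]

theorem integrable_noise [IsFiniteMeasure μ] (h : IsSelectedNoise μ ℱ x g s a K) {t : ℕ}
    (ht : a ≤ t) : Integrable (x t) μ :=
  .of_bound ((h.measurable_noise t ht).mono (ℱ.le _) le_rfl).aestronglyMeasurable K
    (ae_of_all _ (h.abs_noise_le_bound ht))

theorem measurable_expNoise (h : IsSelectedNoise μ ℱ x g s a K) (n : ℕ) :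
    Measurable[ℱ n] (expNoise x g s a n) := by
  refine Real.measurable_exp.comp (Finset.measurable_sum _ fun t ht => ?_)
  rw [Finset.mem_Ico] at ht
  have hx := (h.measurable_noise t ht.1).mono (ℱ.mono ht.2) le_rfl
  have hg := (h.measurable_envelope t ht.1).mono (ℱ.mono ht.2.le) le_rfl
  have hs := (h.measurable_sel t ht.1).mono (ℱ.mono ht.2) le_rfl
  exact hx.sub ((hg.pow_const 2).mul hs)

theorem abs_expNoise_le (h : IsSelectedNoise μ ℱ x g s a K) (n : ℕ) (ω : Ω) :
    |expNoise x g s a n ω| ≤ Real.exp ((n - a : ℕ) * K) := by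
  rw [expNoise, Real.abs_exp, Real.exp_le_exp]
  refine (Finset.sum_le_card_nsmul _ _ K fun t ht => ?_).trans (by simp)
  rw [Finset.mem_Ico] at ht
  have hx := (le_abs_self _).trans (h.abs_noise_le_bound ht.1 ω)
  rcases h.sel_eq t ht.1 ω with hs | hs <;> rw [hs] <;> linarith [sq_nonneg (g t ω)]

theorem integrable_expNoise [IsFiniteMeasure μ] (h : IsSelectedNoise μ ℱ x g s a K) (n : ℕ) :
    Integrable (expNoise x g s a n) μ :=
  .of_bound ((h.measurable_expNoise n).mono (ℱ.le n) le_rfl).aestronglyMeasurable _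
    (ae_of_all _ (h.abs_expNoise_le n))

theorem integral_expNoise_succ_le [IsFiniteMeasure μ] (h : IsSelectedNoise μ ℱ x g s a K)
    (hn : a ≤ n) : ∫ ω, expNoise x g s a (n + 1) ω ∂μ ≤ ∫ ω, expNoise x g s a n ω ∂μ := by
  set W : Ω → ℝ := fun ω => expNoise x g s a n ω * Real.exp (-g n ω ^ 2) with hW
  have hW_meas : Measurable[ℱ n] W := (h.measurable_expNoise n).mul
    (Real.measurable_exp.comp ((h.measurable_envelope n hn).pow_const 2).neg)
  have hW_le (ω : Ω) : |W ω| ≤ Real.exp ((n - a : ℕ) * K) := by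
    rw [hW, abs_mul, Real.abs_exp]
    exact (mul_le_of_le_one_right (abs_nonneg _)
      (Real.exp_le_one_iff.mpr (neg_nonpos.mpr (sq_nonneg _)))).trans (h.abs_expNoise_le n ω)
  have hWx : Integrable (fun ω => W ω * x n ω) μ :=
    (h.integrable_noise hn).bdd_mul (hW_meas.mono (ℱ.le n) le_rfl).aestronglyMeasurable
      (ae_of_all _ hW_le)
  have hstep (ω : Ω) : expNoise x g s a (n + 1) ω ≤ expNoise x g s a n ω + W ω * x n ω :=
    calc expNoise x g s a (n + 1) ω
        = expNoise x g s a n ω * Real.exp (x n ω - g n ω ^ 2 * s n ω) := by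
          rw [expNoise, Finset.sum_Ico_succ_top hn, Real.exp_add, ← expNoise]
      _ ≤ expNoise x g s a n ω * (1 + x n ω * Real.exp (-g n ω ^ 2)) :=
          mul_le_mul_of_nonneg_left (exp_sub_sq_mul_le (h.sel_eq n hn ω) (h.abs_noise_le n hn ω))
            (Real.exp_pos _).le
      _ = expNoise x g s a n ω + W ω * x n ω := by rw [hW]; ring
  calc ∫ ω, expNoise x g s a (n + 1) ω ∂μ
      ≤ ∫ ω, (expNoise x g s a n ω + W ω * x n ω) ∂μ :=
        integral_mono (h.integrable_expNoise _) ((h.integrable_expNoise n).add hWx) hstep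
    _ = ∫ ω, expNoise x g s a n ω ∂μ := by
        rw [integral_add (h.integrable_expNoise n) hWx,
          integral_mul_eq_zero_of_condExp_eq_zero (ℱ.le n) (h.integrable_noise hn)
            hW_meas hW_le (h.condExp_eq_zero n hn), add_zero]

variable [IsProbabilityMeasure μ]

theorem integral_expNoise_le_one (h : IsSelectedNoise μ ℱ x g s a K) (hn : a ≤ n) :
    ∫ ω, expNoise x g s a n ω ∂μ ≤ 1 := by
  induction n, hn using Nat.le_induction with
  | base => simp [expNoise]
  | succ n hn ih => exact (h.integral_expNoise_succ_le hn).trans ih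

theorem measureReal_le_sum_le_exp (h : IsSelectedNoise μ ℱ x g s a K) (hn : a ≤ n) (A V : ℝ) :
    μ.real {ω | A ≤ ∑ t ∈ Finset.Ico a n, x t ω ∧
      ∑ t ∈ Finset.Ico a n, g t ω ^ 2 * s t ω ≤ V} ≤ Real.exp (V - A) := by
  have hsub : {ω | A ≤ ∑ t ∈ Finset.Ico a n, x t ω ∧
      ∑ t ∈ Finset.Ico a n, g t ω ^ 2 * s t ω ≤ V} ⊆
        {ω | Real.exp (A - V) ≤ expNoise x g s a n ω} := by
    rintro ω ⟨hA, hV⟩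
    rw [Set.mem_ofPred_eq, expNoise, Real.exp_le_exp, Finset.sum_sub_distrib]
    linarith
  have hmarkov : Real.exp (A - V) * μ.real {ω | Real.exp (A - V) ≤ expNoise x g s a n ω} ≤ 1 :=
    (mul_meas_ge_le_integral_of_nonneg (ae_of_all _ fun _ => (Real.exp_pos _).le)
      (h.integrable_expNoise n) _).trans (h.integral_expNoise_le_one hn)
  calc _ ≤ μ.real {ω | Real.exp (A - V) ≤ expNoise x g s a n ω} := measureReal_mono hsub
    _ ≤ (Real.exp (A - V))⁻¹ := by rwa [← one_div, le_div_iff₀' (Real.exp_pos _)]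
    _ = Real.exp (V - A) := by rw [← Real.exp_neg, neg_sub]

theorem measureReal_le_const_mul_sum_le_exp (h : IsSelectedNoise μ ℱ x g s a K) (hn : a ≤ n)
    (lam A V : ℝ) :
    μ.real {ω | A ≤ lam * ∑ t ∈ Finset.Ico a n, x t ω ∧
      ∑ t ∈ Finset.Ico a n, g t ω ^ 2 * s t ω ≤ V} ≤ Real.exp (lam ^ 2 * V - A) := by
  refine (measureReal_mono ?_).trans
    ((h.const_mul lam).measureReal_le_sum_le_exp hn A (lam ^ 2 * V))
  rintro ω ⟨hA, hV⟩
  simp only [Set.mem_ofPred_eq, mul_pow, mul_assoc, ← Finset.mul_sum]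
  exact ⟨hA, by gcongr⟩

theorem measureReal_lt_abs_sum_le_exp (h : IsSelectedNoise μ ℱ x g s a K) (hn : a ≤ n)
    {ℓ V : ℝ} (hV : 0 < V) (hℓ : 0 ≤ ℓ) :
    μ.real {ω | 2 * √(ℓ * V) < |∑ t ∈ Finset.Ico a n, x t ω| ∧
      ∑ t ∈ Finset.Ico a n, g t ω ^ 2 * s t ω ≤ V} ≤ 2 * Real.exp (-ℓ) := by
  -- `lam = √(ℓ / V)` minimizes the exponent `lam ^ 2 * V - lam * (2 * √(ℓ * V))`.
  have hexp : √(ℓ / V) ^ 2 * V - 2 * ℓ = -ℓ := by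
    rw [Real.sq_sqrt (by positivity)]
    field_simp
    ring
  have hlevel : √(ℓ / V) * (2 * √(ℓ * V)) = 2 * ℓ := by
    rw [mul_left_comm, ← Real.sqrt_mul (by positivity), show ℓ / V * (ℓ * V) = ℓ ^ 2 by field_simp,
      Real.sqrt_sq hℓ]
  have hpos := h.measureReal_le_const_mul_sum_le_exp hn √(ℓ / V) (2 * ℓ) V
  have hneg := h.measureReal_le_const_mul_sum_le_exp hn (-√(ℓ / V)) (2 * ℓ) V
  rw [neg_sq] at hneg
  rw [hexp] at hpos hneg
  rw [two_mul (Real.exp _)]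
  refine (measureReal_mono ?_).trans ((measureReal_union_le _ _).trans (add_le_add hpos hneg))
  rintro ω ⟨hsum, hvar⟩
  rcases lt_abs.mp hsum with hsum | hsum
  · exact .inl ⟨hlevel ▸ by gcongr, hvar⟩
  · exact .inr ⟨by rw [neg_mul, ← mul_neg, ← hlevel]; gcongr, hvar⟩

end IsSelectedNoise

end Deviation

variable {Ω 𝒳 𝒴 : Type*} [m0 : MeasurableSpace Ω] [MeasurableSpace 𝒳] [MeasurableSpace 𝒴]

section History

theorem DataStream.past_le (P : DataStream Ω 𝒳 𝒴) (t : ℤ) : P.past t ≤ m0 :=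
  iSup₂_le fun k hk => ((P.measurable_X k hk.1).prodMk (P.measurable_Y k hk.1)).comap_le

theorem DataStream.past_mono (P : DataStream Ω 𝒳 𝒴) : Monotone P.past := fun _ _ hst =>
  iSup₂_le fun k hk => le_iSup₂_of_le k ⟨hk.1, hk.2.trans hst⟩ le_rfl

/-- The information `𝓕_{t-1}` available before the arrival of the pair with index `t`. -/
def DataStream.history (P : DataStream Ω 𝒳 𝒴) : Filtration ℕ m0 where
  seq t := P.past ((t : ℤ) - 1)
  mono' _ _ hst := P.past_mono (by omega)
  le' t := P.past_le _

theorem DataStream.measurable_pair (P : DataStream Ω 𝒳 𝒴) {t : ℕ} (ht : 1 ≤ t) :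
    Measurable[P.history (t + 1)] (fun ω => (P.X t ω, P.Y t ω)) := by
  rw [measurable_iff_comap_le]
  exact le_iSup₂_of_le (t : ℤ) ⟨by omega, by push_cast; omega⟩ le_rfl

variable {P : DataStream Ω 𝒳 𝒴}

theorem DataStream.measurable_history_prodMk {E : Type*} [mE : MeasurableSpace E] {t : ℕ}
    {Z : Ω → E} (hZ : Measurable[P.history (t + 1)] Z) :
    @Measurable Ω (Ω × E) (P.history (t + 1)) ((P.history t).prod mE) fun ω => (ω, Z ω) :=
  @Measurable.prodMk Ω (P.history (t + 1)) Ω E (P.history t) mE id Z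
    (measurable_id'' (P.history.mono t.le_succ)) hZ

variable (R : Rules P) {t : ℕ} {q : Ω → ℝ}

theorem Rules.measurable_sel_comp (ht : 1 ≤ t) (hq : Measurable[P.history t] q) :
    Measurable[P.history (t + 1)] fun ω => R.sel t ω (P.X t ω) (q ω) :=
  (R.measurable_sel t ht).comp <| DataStream.measurable_history_prodMk <|
    (measurable_fst.comp (P.measurable_pair ht)).prodMk (hq.mono (P.history.mono t.le_succ) le_rfl)

theorem Rules.measurable_err_comp (ht : 1 ≤ t) (hq : Measurable[P.history t] q) :
    Measurable[P.history (t + 1)]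
      fun ω => R.err t (P.Y t ω) (R.predSet t ω (P.X t ω) (q ω)) :=
  (R.measurable_err t ht).comp <| DataStream.measurable_history_prodMk <|
    (measurable_fst.comp (P.measurable_pair ht)).prodMk <|
      (hq.mono (P.history.mono t.le_succ) le_rfl).prodMk
        (measurable_snd.comp (P.measurable_pair ht))

end History

section Path

variable {P : DataStream Ω 𝒳 𝒴} (R : Rules P) (γ : ℕ → ℝ) (α q₁ : ℝ)

/-- The selection indicator `S_t(X_t, q_t)`, as a real number. -/
noncomputable def selAt (t : ℕ) (ω : Ω) : ℝ := R.sel t ω (P.X t ω) (threshold R γ α q₁ t ω)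

/-- The error `err_t(Y_t, 𝒞_t(X_t, q_t))`. -/
noncomputable def errAt (t : ℕ) (ω : Ω) : ℝ :=
  R.err t (P.Y t ω) (R.predSet t ω (P.X t ω) (threshold R γ α q₁ t ω))

/-- The reaction `err_t(Y_t, 𝒞_t(X_t, q_t)) 1{q_t ≥ 0} + 1{q_t < 0}`. -/
noncomputable def reactAt (t : ℕ) (ω : Ω) : ℝ :=
  react R t (P.Y t ω) (R.predSet t ω (P.X t ω) (threshold R γ α q₁ t ω)) (threshold R γ α q₁ t ω)

/-- The effective step size `γ_{J(t)} S_t(X_t, q_t)`. -/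
noncomputable def weight (t : ℕ) (ω : Ω) : ℝ :=
  γ (selNumber R γ α q₁ t ω) * selAt R γ α q₁ t ω

variable {t : ℕ} (ω : Ω)

theorem one_le_selNumber (t : ℕ) : 1 ≤ selNumber R γ α q₁ t ω := Nat.succ_le_succ (Nat.zero_le _)

theorem selNumber_mono : Monotone fun t => selNumber R γ α q₁ t ω := fun s t hst => by
  simp only [selNumber]
  gcongr

theorem cast_selNumber_succ (ht : 1 ≤ t) :
    (selNumber R γ α q₁ (t + 1) ω : ℝ) = selNumber R γ α q₁ t ω + selAt R γ α q₁ t ω := by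
  rw [selNumber, Finset.sum_Ico_succ_top ht, selNumber, selAt]
  push_cast
  ring

theorem sum_selAt {s : ℕ} (hs : 1 ≤ s) (hst : s ≤ t) :
    ∑ i ∈ Finset.Ico s t, selAt R γ α q₁ i ω = selNumber R γ α q₁ t ω - selNumber R γ α q₁ s ω := by
  rw [← Finset.sum_Ico_sub (fun t => (selNumber R γ α q₁ t ω : ℝ)) hst]
  refine Finset.sum_congr rfl fun i hi => ?_
  rw [cast_selNumber_succ R γ α q₁ ω (hs.trans (Finset.mem_Ico.mp hi).1), add_sub_cancel_left]

theorem threshold_succ_eq_add_weight_mul (ht : 1 ≤ t) :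
    threshold R γ α q₁ (t + 1) ω = threshold R γ α q₁ t ω
      + weight R γ α q₁ t ω * (reactAt R γ α q₁ t ω - α) := by
  rw [threshold_succ R γ α q₁ t ht, weight, selAt, reactAt]
  ring

theorem selAt_eq_zero_or_one (ht : 1 ≤ t) : selAt R γ α q₁ t ω = 0 ∨ selAt R γ α q₁ t ω = 1 :=
  (R.sel_zero_or_one t ht ω _ _).imp Nat.cast_eq_zero.mpr Nat.cast_eq_one.mpr

theorem selAt_nonneg (t : ℕ) : 0 ≤ selAt R γ α q₁ t ω := Nat.cast_nonneg _

theorem selAt_le_one (ht : 1 ≤ t) : selAt R γ α q₁ t ω ≤ 1 := by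
  rcases selAt_eq_zero_or_one R γ α q₁ ω ht with h | h <;> linarith

theorem selNumber_le (ht : 1 ≤ t) : selNumber R γ α q₁ t ω ≤ t := by
  have hsum := Finset.sum_le_card_nsmul (Finset.Ico 1 t)
    (fun i => R.sel i ω (P.X i ω) (threshold R γ α q₁ i ω)) 1 fun i hi => by
      rcases R.sel_zero_or_one i (Finset.mem_Ico.mp hi).1 ω (P.X i ω) (threshold R γ α q₁ i ω)
        with h | h <;> omega
  rw [Nat.card_Ico, smul_eq_mul, mul_one] at hsum
  rw [selNumber]
  omega

theorem errAt_mem_Icc (ht : 1 ≤ t) : errAt R γ α q₁ t ω ∈ Set.Icc (0 : ℝ) 1 := R.err_mem t ht _ _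

theorem reactAt_mem_Icc (ht : 1 ≤ t) : reactAt R γ α q₁ t ω ∈ Set.Icc (0 : ℝ) 1 := by
  unfold reactAt react
  split_ifs
  exacts [R.err_mem t ht _ _, ⟨zero_le_one, le_rfl⟩]

variable {ω}

theorem reactAt_of_nonneg (h : 0 ≤ threshold R γ α q₁ t ω) :
    reactAt R γ α q₁ t ω = errAt R γ α q₁ t ω := if_pos h

theorem reactAt_of_neg (h : threshold R γ α q₁ t ω < 0) : reactAt R γ α q₁ t ω = 1 :=
  if_neg h.not_ge

theorem weight_mul_reactAt_of_ge (ht : 1 ≤ t) (h : R.B ≤ threshold R γ α q₁ t ω) :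
    weight R γ α q₁ t ω * reactAt R γ α q₁ t ω = 0 := by
  rcases R.above_B t ht ω (P.X t ω) _ h with huniv | hsel
  · rw [reactAt_of_nonneg R γ α q₁ (R.B_pos.le.trans h), errAt, huniv, R.err_univ t ht, mul_zero]
  · rw [weight, selAt, hsel, Nat.cast_zero, mul_zero, zero_mul]

variable {R γ α q₁}

theorem weight_nonneg (hγ : ∀ j, 0 ≤ γ j) (t : ℕ) (ω : Ω) : 0 ≤ weight R γ α q₁ t ω :=
  mul_nonneg (hγ _) (selAt_nonneg R γ α q₁ ω t)

theorem weight_le (hγ : ∀ j, 0 ≤ γ j) {b : ℝ} (ht : 1 ≤ t)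
    (hb : γ (selNumber R γ α q₁ t ω) ≤ b) : weight R γ α q₁ t ω ≤ b :=
  (mul_le_of_le_one_right (hγ _) (selAt_le_one R γ α q₁ ω ht)).trans hb

theorem abs_threshold_succ_sub_le (hα : α ∈ Set.Icc (0 : ℝ) 1) (hγ : ∀ j, 0 ≤ γ j) {b : ℝ}
    (ht : 1 ≤ t) (hb : γ (selNumber R γ α q₁ t ω) ≤ b) :
    |threshold R γ α q₁ (t + 1) ω - threshold R γ α q₁ t ω| ≤ b := by
  have hreact := reactAt_mem_Icc R γ α q₁ ω ht
  rw [threshold_succ_eq_add_weight_mul R γ α q₁ ω ht, add_sub_cancel_left, abs_mul,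
    abs_of_nonneg (weight_nonneg hγ t ω)]
  refine (mul_le_of_le_one_right (weight_nonneg hγ t ω) ?_).trans (weight_le hγ ht hb)
  exact abs_le.mpr ⟨by linarith [hreact.1, hα.2], by linarith [hreact.2, hα.1]⟩

theorem threshold_mem_Icc (hα : α ∈ Set.Icc (0 : ℝ) 1) (hq₁ : q₁ ∈ Set.Icc 0 R.B)
    (hγ : ∀ j, 0 ≤ γ j) {c : ℝ} (hc : ∀ j, 1 ≤ j → γ j ≤ c) (ht : 1 ≤ t) (ω : Ω) :
    threshold R γ α q₁ t ω ∈ Set.Icc (-c) (R.B + c) := by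
  have hc_nonneg : 0 ≤ c := (hγ 1).trans (hc 1 le_rfl)
  induction t, ht using Nat.le_induction with
  | base => exact ⟨by linarith [hq₁.1, threshold_one R γ α q₁ ω],
      by linarith [hq₁.2, threshold_one R γ α q₁ ω]⟩
  | succ t ht ih =>
    have hstep := abs_le.mp (abs_threshold_succ_sub_le hα hγ ht
      (hc _ (one_le_selNumber R γ α q₁ ω t)))
    have hsucc := threshold_succ_eq_add_weight_mul R γ α q₁ ω ht
    have hweight := weight_nonneg (R := R) (α := α) (q₁ := q₁) hγ t ω
    have hB := R.B_pos
    constructor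
    · rcases lt_or_ge (threshold R γ α q₁ t ω) 0 with hneg | hnonneg
      · rw [reactAt_of_neg R γ α q₁ hneg] at hsucc
        linarith [ih.1, mul_nonneg hweight (sub_nonneg.mpr hα.2)]
      · linarith
    · rcases lt_or_ge (threshold R γ α q₁ t ω) R.B with hlt | hge
      · linarith
      · rw [mul_sub, weight_mul_reactAt_of_ge R γ α q₁ ht hge] at hsucc
        linarith [ih.2, mul_nonneg hweight hα.1]

variable (R γ α q₁)

theorem measurable_threshold_and_selNumber (ht : 1 ≤ t) :
    Measurable[P.history t] (threshold R γ α q₁ t) ∧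
      Measurable[P.history t] (selNumber R γ α q₁ t) := by
  induction t, ht using Nat.le_induction with
  | base =>
    exact ⟨measurable_const (a := q₁), measurable_const (a := 1)⟩
  | succ t ht ih =>
    have hmono := P.history.mono t.le_succ
    have hq := ih.1.mono hmono le_rfl
    have hJ := ih.2.mono hmono le_rfl
    have hsel := R.measurable_sel_comp ht ih.1
    have hreact : Measurable[P.history (t + 1)] (reactAt R γ α q₁ t) :=
      Measurable.ite (hq measurableSet_Ici) (R.measurable_err_comp ht ih.1) measurable_const
    have hweight : Measurable[P.history (t + 1)] (weight R γ α q₁ t) :=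
      ((measurable_of_countable γ).comp hJ).mul ((measurable_of_countable Nat.cast).comp hsel)
    constructor
    · rw [show threshold R γ α q₁ (t + 1) = _ from
        funext fun ω => threshold_succ_eq_add_weight_mul R γ α q₁ ω ht]
      exact hq.add (hweight.mul (hreact.sub_const α))
    · have hsucc : selNumber R γ α q₁ (t + 1) = fun ω =>
          selNumber R γ α q₁ t ω + R.sel t ω (P.X t ω) (threshold R γ α q₁ t ω) := by
        funext ω
        rw [selNumber, Finset.sum_Ico_succ_top ht, selNumber]
        ring
      rw [hsucc]
      exact hJ.add hsel

theorem measurable_threshold (ht : 1 ≤ t) : Measurable[P.history t] (threshold R γ α q₁ t) :=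
  (measurable_threshold_and_selNumber R γ α q₁ ht).1

theorem measurable_selNumber (ht : 1 ≤ t) : Measurable[P.history t] (selNumber R γ α q₁ t) :=
  (measurable_threshold_and_selNumber R γ α q₁ ht).2

theorem measurable_selAt (ht : 1 ≤ t) : Measurable[P.history (t + 1)] (selAt R γ α q₁ t) :=
  (measurable_of_countable Nat.cast).comp
    (R.measurable_sel_comp ht (measurable_threshold R γ α q₁ ht))

theorem measurable_errAt (ht : 1 ≤ t) : Measurable[P.history (t + 1)] (errAt R γ α q₁ t) :=
  R.measurable_err_comp ht (measurable_threshold R γ α q₁ ht)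

end Path

section Noise

variable (μ : Measure Ω) {P : DataStream Ω 𝒳 𝒴} (R : Rules P) (γ : ℕ → ℝ) (α q₁ : ℝ)

/-- The instantaneous error rate truncated to `[0, 1]`, where it lies almost surely; the noise is
defined from it in order to be bounded everywhere. -/
noncomputable def ierTrunc (t : ℕ) (ω : Ω) : ℝ := max 0 (min 1 (ier μ R γ α q₁ t ω))

/-- The step size `γ_{J(t)}` at the times when `q_t ∈ [0, B]`, and `0` at the other times: the
predictable envelope of the noise. -/
noncomputable def insideStep (t : ℕ) : Ω → ℝ :=
  (threshold R γ α q₁ t ⁻¹' Set.Icc 0 R.B).indicator fun ω => γ (selNumber R γ α q₁ t ω)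

/-- The martingale increments of the threshold recursion at the times when `q_t ∈ [0, B]`. -/
noncomputable def noise (t : ℕ) (ω : Ω) : ℝ :=
  insideStep R γ α q₁ t ω
    * ((errAt R γ α q₁ t ω - ierTrunc μ R γ α q₁ t ω) * selAt R γ α q₁ t ω)

theorem ierTrunc_mem_Icc (t : ℕ) (ω : Ω) : ierTrunc μ R γ α q₁ t ω ∈ Set.Icc (0 : ℝ) 1 :=
  ⟨le_max_left _ _, max_le zero_le_one (min_le_left _ _)⟩

theorem abs_ierTrunc_le_one (t : ℕ) (ω : Ω) : |ierTrunc μ R γ α q₁ t ω| ≤ 1 := by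
  have hmem := ierTrunc_mem_Icc μ R γ α q₁ t ω
  exact abs_le.mpr ⟨by linarith [hmem.1], hmem.2⟩

theorem measurable_ierTrunc (t : ℕ) : Measurable[P.history t] (ierTrunc μ R γ α q₁ t) :=
  measurable_const.max (measurable_const.min
    (stronglyMeasurable_condExp.measurable.div stronglyMeasurable_condExp.measurable))

variable {μ R γ α q₁} in
theorem ierTrunc_of_mem_Icc {t : ℕ} {ω : Ω} (h : ier μ R γ α q₁ t ω ∈ Set.Icc (0 : ℝ) 1) :
    ierTrunc μ R γ α q₁ t ω = ier μ R γ α q₁ t ω := by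
  rw [ierTrunc, min_eq_right h.2, max_eq_right h.1]

variable {t : ℕ}

theorem abs_errAt_sub_ierTrunc_le_one (ht : 1 ≤ t) (ω : Ω) :
    |errAt R γ α q₁ t ω - ierTrunc μ R γ α q₁ t ω| ≤ 1 := by
  have herr := errAt_mem_Icc R γ α q₁ ω ht
  have hier := ierTrunc_mem_Icc μ R γ α q₁ t ω
  exact abs_le.mpr ⟨by linarith [herr.1, hier.2], by linarith [herr.2, hier.1]⟩

variable {ω : Ω}

theorem noise_of_mem_Icc (hq : threshold R γ α q₁ t ω ∈ Set.Icc 0 R.B) :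
    noise μ R γ α q₁ t ω
      = weight R γ α q₁ t ω * (errAt R γ α q₁ t ω - ierTrunc μ R γ α q₁ t ω) := by
  rw [noise, insideStep, Set.indicator_of_mem (Set.mem_preimage.mpr hq), weight]
  ring

theorem noise_of_notMem_Icc (hq : threshold R γ α q₁ t ω ∉ Set.Icc 0 R.B) :
    noise μ R γ α q₁ t ω = 0 := by
  rw [noise, insideStep, Set.indicator_of_notMem (by exact hq), zero_mul]

variable (ω)

theorem abs_insideStep_le (hγ : ∀ j, 0 ≤ γ j) (t : ℕ) :
    |insideStep R γ α q₁ t ω| ≤ γ (selNumber R γ α q₁ t ω) :=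
  (norm_indicator_le_norm_self _ ω).trans_eq (Real.norm_of_nonneg (hγ _))

theorem measurable_insideStep (ht : 1 ≤ t) : Measurable[P.history t] (insideStep R γ α q₁ t) :=
  ((measurable_of_countable γ).comp (measurable_selNumber R γ α q₁ ht)).indicator
    (measurable_threshold R γ α q₁ ht measurableSet_Icc)

theorem errAt_mul_selAt_nonneg (ht : 1 ≤ t) (ω : Ω) :
    0 ≤ errAt R γ α q₁ t ω * selAt R γ α q₁ t ω :=
  mul_nonneg (errAt_mem_Icc R γ α q₁ ω ht).1 (selAt_nonneg R γ α q₁ ω t)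

theorem errAt_mul_selAt_le (ht : 1 ≤ t) (ω : Ω) :
    errAt R γ α q₁ t ω * selAt R γ α q₁ t ω ≤ selAt R γ α q₁ t ω :=
  mul_le_of_le_one_left (selAt_nonneg R γ α q₁ ω t) (errAt_mem_Icc R γ α q₁ ω ht).2

variable [IsFiniteMeasure μ]

theorem integrable_selAt (ht : 1 ≤ t) : Integrable (selAt R γ α q₁ t) μ :=
  .of_bound ((measurable_selAt R γ α q₁ ht).mono (P.history.le _) le_rfl).aestronglyMeasurable 1 <|
    ae_of_all _ fun ω => by
      rw [Real.norm_of_nonneg (selAt_nonneg R γ α q₁ ω t)]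
      exact selAt_le_one R γ α q₁ ω ht

theorem integrable_errAt_mul_selAt (ht : 1 ≤ t) :
    Integrable (fun ω => errAt R γ α q₁ t ω * selAt R γ α q₁ t ω) μ :=
  (integrable_selAt μ R γ α q₁ ht).mono'
    (((measurable_errAt R γ α q₁ ht).mul (measurable_selAt R γ α q₁ ht)).mono
      (P.history.le _) le_rfl).aestronglyMeasurable <|
    ae_of_all _ fun ω => by
      rw [Real.norm_of_nonneg (errAt_mul_selAt_nonneg R γ α q₁ ht ω)]
      exact errAt_mul_selAt_le R γ α q₁ ht ω

theorem ier_mem_Icc (ht : 1 ≤ t) : ∀ᵐ ω ∂μ, ier μ R γ α q₁ t ω ∈ Set.Icc (0 : ℝ) 1 :=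
  condExp_div_condExp_mem_Icc (integrable_errAt_mul_selAt μ R γ α q₁ ht)
    (integrable_selAt μ R γ α q₁ ht) (errAt_mul_selAt_nonneg R γ α q₁ ht)
    (errAt_mul_selAt_le R γ α q₁ ht)

theorem condExp_errAt_mul_selAt (ht : 1 ≤ t) :
    μ[fun ω => errAt R γ α q₁ t ω * selAt R γ α q₁ t ω | P.history t]
      =ᵐ[μ] ierTrunc μ R γ α q₁ t * μ[selAt R γ α q₁ t | P.history t] := by
  filter_upwards [ier_mem_Icc μ R γ α q₁ ht, condExp_div_condExp_mul_cancel (m := P.history t)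
    (integrable_errAt_mul_selAt μ R γ α q₁ ht) (integrable_selAt μ R γ α q₁ ht)
    (errAt_mul_selAt_nonneg R γ α q₁ ht) (errAt_mul_selAt_le R γ α q₁ ht)] with ω hier hcancel
  rw [Pi.mul_apply, ierTrunc_of_mem_Icc hier]
  exact hcancel.symm

theorem condExp_errAt_sub_ierTrunc_mul_selAt (ht : 1 ≤ t) :
    μ[fun ω => (errAt R γ α q₁ t ω - ierTrunc μ R γ α q₁ t ω) * selAt R γ α q₁ t ω | P.history t]
      =ᵐ[μ] 0 := by
  convert condExp_sub_mul_eq_zero (P.history.le t) (integrable_errAt_mul_selAt μ R γ α q₁ ht)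
    (integrable_selAt μ R γ α q₁ ht) (measurable_ierTrunc μ R γ α q₁ t)
    (abs_ierTrunc_le_one μ R γ α q₁ t) (condExp_errAt_mul_selAt μ R γ α q₁ ht) using 2
  exact funext fun ω => sub_mul _ _ _

theorem isSelectedNoise_noise (hγ : ∀ j, 0 ≤ γ j) {c : ℝ} (hc : ∀ j, 1 ≤ j → γ j ≤ c) :
    IsSelectedNoise μ P.history (noise μ R γ α q₁) (insideStep R γ α q₁) (selAt R γ α q₁) 1 c := by
  have hcentered (t : ℕ) (ht : 1 ≤ t) : Measurable[P.history (t + 1)] fun ω =>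
      errAt R γ α q₁ t ω - ierTrunc μ R γ α q₁ t ω :=
    (measurable_errAt R γ α q₁ ht).sub
      ((measurable_ierTrunc μ R γ α q₁ t).mono (P.history.mono t.le_succ) le_rfl)
  have hstep_le (t : ℕ) (ω : Ω) : |insideStep R γ α q₁ t ω| ≤ c :=
    (abs_insideStep_le R γ α q₁ ω hγ t).trans (hc _ (one_le_selNumber R γ α q₁ ω t))
  refine ⟨fun t ht => ?_, fun t ht => measurable_insideStep R γ α q₁ ht,
    fun t ht => measurable_selAt R γ α q₁ ht, fun t ht ω => selAt_eq_zero_or_one R γ α q₁ ω ht,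
    fun t ht ω => ?_, fun t _ => hstep_le t, fun t ht => ?_⟩
  · exact ((measurable_insideStep R γ α q₁ ht).mono (P.history.mono t.le_succ) le_rfl).mul
      ((hcentered t ht).mul (measurable_selAt R γ α q₁ ht))
  · rw [noise, abs_mul, abs_mul, abs_of_nonneg (selAt_nonneg R γ α q₁ ω t)]
    gcongr
    exact mul_le_of_le_one_left (selAt_nonneg R γ α q₁ ω t)
      (abs_errAt_sub_ierTrunc_le_one μ R γ α q₁ ht ω)
  · refine condExp_mul_eq_zero (P.history.le t) ?_ (measurable_insideStep R γ α q₁ ht) (hstep_le t)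
      (condExp_errAt_sub_ierTrunc_mul_selAt μ R γ α q₁ ht)
    exact (integrable_selAt μ R γ α q₁ ht).bdd_mul
      ((hcentered t ht).mono (P.history.le _) le_rfl).aestronglyMeasurable
      (ae_of_all _ (abs_errAt_sub_ierTrunc_le_one μ R γ α q₁ ht))

end Noise

section Crossing

/-- Linear crossing of the level `α` at `q₀` by a function on `[0, B]`: on either side of `q₀` it
leaves the level `α` downwards at rate at least `κ` up to distance `δ`, and never comes back closer
than `κ * δ` beyond, while it deviates from `α` at most at rate `L`. The bounds `1 ≤ L * q₀` and
`1 ≤ L * (B - q₀)` make `L * |q - q₀|` dominate any error rate when `q ∉ [0, B]`. -/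
structure IsLinearCrossing (B α q₀ : ℝ) (Pi0 : ℝ → ℝ) (δ κ L : ℝ) : Prop where
  δ_pos : 0 < δ
  κ_pos : 0 < κ
  L_pos : 0 < L
  mul_le : κ * δ ≤ α
  mul_le_one_sub : κ * δ ≤ 1 - α
  le_right : ∀ q ∈ Set.Icc q₀ B, Pi0 q ≤ α - κ * min (q - q₀) δ
  le_left : ∀ q ∈ Set.Icc 0 q₀, α + κ * min (q₀ - q) δ ≤ Pi0 q
  lipschitz : ∀ q ∈ Set.Icc 0 B, |Pi0 q - α| ≤ L * |q - q₀|
  one_le_left : 1 ≤ L * q₀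
  one_le_right : 1 ≤ L * (B - q₀)

theorem exists_abs_sub_le_of_hasDerivAt_neg {f : ℝ → ℝ} {x d : ℝ} (hf : HasDerivAt f d x)
    (hd : d < 0) :
    ∃ δ > 0, ∀ y, |y - x| ≤ δ → |f y - f x - (y - x) * d| ≤ -d / 2 * |y - x| := by
  obtain ⟨δ, hδ, hball⟩ := Metric.eventually_nhds_iff.mp
    (hf.isLittleO.def (c := -d / 2) (by linarith))
  refine ⟨δ / 2, half_pos hδ, fun y hy => ?_⟩
  simpa only [Real.norm_eq_abs, smul_eq_mul] using
    hball (y := y) (by rw [Real.dist_eq]; linarith)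

variable {B α q₀ : ℝ} {Pi0 : ℝ → ℝ} {δ κ L : ℝ}

namespace IsBenchmark

theorem mem_Icc (h : IsBenchmark B α q₀ Pi0) : q₀ ∈ Set.Icc 0 B :=
  Set.Ioo_subset_Icc_self h.q₀_mem

theorem exists_local_bounds (h : IsBenchmark B α q₀ Pi0) :
    ∃ δ κ, 0 < δ ∧ 0 < κ ∧ δ ≤ q₀ ∧ δ ≤ B - q₀ ∧
      (∀ q ∈ Set.Icc q₀ (q₀ + δ), Pi0 q ≤ α - κ * (q - q₀)) ∧
      (∀ q ∈ Set.Icc (q₀ - δ) q₀, α + κ * (q₀ - q) ≤ Pi0 q) ∧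
      ∀ q, |q - q₀| ≤ δ → |Pi0 q - α| ≤ 3 * κ * |q - q₀| := by
  obtain ⟨hq₀, hq₀B⟩ := h.q₀_mem
  have hd := h.deriv_neg
  obtain ⟨r, hr, hlin⟩ := exists_abs_sub_le_of_hasDerivAt_neg
    (differentiableAt_of_deriv_ne_zero hd.ne).hasDerivAt hd
  rw [h.value] at hlin
  set d := deriv Pi0 q₀
  refine ⟨min r (min q₀ (B - q₀)), -d / 2, lt_min hr (lt_min hq₀ (sub_pos.mpr hq₀B)),
    by linarith, (min_le_right _ _).trans (min_le_left _ _),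
    (min_le_right _ _).trans (min_le_right _ _), fun q hq => ?_, fun q hq => ?_, fun q hq => ?_⟩
  · have habs := abs_of_nonneg (sub_nonneg.mpr hq.1)
    have hqr := hlin q (by rw [habs]; linarith [hq.2, min_le_left r (min q₀ (B - q₀))])
    rw [habs] at hqr
    linarith [(abs_le.mp hqr).2]
  · have habs := abs_of_nonpos (sub_nonpos.mpr hq.2)
    have hqr := hlin q (by rw [habs]; linarith [hq.1, min_le_left r (min q₀ (B - q₀))])
    rw [habs] at hqr
    linarith [(abs_le.mp hqr).1]
  · have hqr := hlin q (hq.trans (min_le_left _ _))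
    have htri := abs_add_le (Pi0 q - α - (q - q₀) * d) ((q - q₀) * d)
    rw [sub_add_cancel, abs_mul, abs_of_neg hd] at htri
    linarith

theorem exists_isLinearCrossing (h : IsBenchmark B α q₀ Pi0) :
    ∃ δ κ L, IsLinearCrossing B α q₀ Pi0 δ κ L := by
  obtain ⟨δ, κ, hδ, hκ, hδq₀, hδB, hright, hleft, hlip⟩ := h.exists_local_bounds
  have hα := h.value ▸ h.mem_unit q₀ h.mem_Icc
  have hfar {x : ℝ} (hx : δ ≤ x) : 1 ≤ (3 * κ + δ⁻¹) * x := by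
    have hinv : 1 ≤ δ⁻¹ * x := by rwa [← div_eq_inv_mul, one_le_div hδ]
    linarith [mul_nonneg (by positivity : 0 ≤ 3 * κ) (hδ.le.trans hx)]
  have hend_right := hright (q₀ + δ) ⟨by linarith, le_rfl⟩
  have hend_left := hleft (q₀ - δ) ⟨le_rfl, by linarith⟩
  rw [add_sub_cancel_left] at hend_right
  rw [sub_sub_cancel] at hend_left
  refine ⟨δ, κ, 3 * κ + δ⁻¹, hδ, hκ, by positivity,
    by linarith [(h.mem_unit (q₀ + δ) ⟨by linarith, by linarith⟩).1],
    by linarith [(h.mem_unit (q₀ - δ) ⟨by linarith, by linarith⟩).2],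
    fun q hq => ?_, fun q hq => ?_, fun q hq => ?_, hfar hδq₀, hfar hδB⟩
  · rcases le_total (q - q₀) δ with hqδ | hqδ
    · rw [min_eq_left hqδ]
      exact hright q ⟨hq.1, by linarith⟩
    · rw [min_eq_right hqδ]
      exact (h.antitone ⟨by linarith, by linarith⟩ ⟨by linarith, hq.2⟩ (by linarith)).trans
        hend_right
  · rcases le_total (q₀ - q) δ with hqδ | hqδ
    · rw [min_eq_left hqδ]
      exact hleft q ⟨by linarith, hq.2⟩
    · rw [min_eq_right hqδ]
      exact hend_left.trans
        (h.antitone ⟨hq.1, by linarith [hq.2]⟩ ⟨by linarith, by linarith⟩ (by linarith))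
  · rcases le_total |q - q₀| δ with hqδ | hqδ
    · refine (hlip q hqδ).trans ?_
      gcongr
      exact le_add_of_nonneg_right (by positivity)
    · exact (abs_sub_le_of_le_of_le (h.mem_unit q hq).1 (h.mem_unit q hq).2 hα.1 hα.2).trans
        (by linarith [hfar hqδ])

end IsBenchmark

namespace IsLinearCrossing

variable (h : IsLinearCrossing B α q₀ Pi0 δ κ L) {ε q p : ℝ}
include h

theorem level_mem_Icc : α ∈ Set.Icc (0 : ℝ) 1 := by
  have hpos := mul_pos h.κ_pos h.δ_pos
  exact ⟨by linarith [h.mul_le], by linarith [h.mul_le_one_sub]⟩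

theorem point_mem_Ioo : q₀ ∈ Set.Ioo 0 B :=
  ⟨(pos_iff_pos_of_mul_pos (one_pos.trans_le h.one_le_left)).mp h.L_pos,
    sub_pos.mp ((pos_iff_pos_of_mul_pos (one_pos.trans_le h.one_le_right)).mp h.L_pos)⟩

theorem le_sub_of_le (hεδ : ε ≤ δ) (hε : ε ≤ q - q₀) (hq : q ∈ Set.Icc q₀ B) :
    Pi0 q ≤ α - κ * ε :=
  (h.le_right q hq).trans
    (sub_le_sub_left (mul_le_mul_of_nonneg_left (le_min hε hεδ) h.κ_pos.le) α)

theorem add_le_of_le (hεδ : ε ≤ δ) (hε : ε ≤ q₀ - q) (hq : q ∈ Set.Icc 0 q₀) :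
    α + κ * ε ≤ Pi0 q :=
  (add_le_add_right (mul_le_mul_of_nonneg_left (le_min hε hεδ) h.κ_pos.le) α).trans
    (h.le_left q hq)

theorem abs_sub_le_of_notMem (hq : q ∉ Set.Icc 0 B) (hp : p ∈ Set.Icc (0 : ℝ) 1) :
    |p - α| ≤ L * |q - q₀| := by
  have hα := h.level_mem_Icc
  refine (abs_sub_le_of_le_of_le hp.1 hp.2 hα.1 hα.2).trans ?_
  rw [sub_zero]
  rcases lt_or_ge q 0 with hneg | hnonneg
  · refine h.one_le_left.trans (mul_le_mul_of_nonneg_left ?_ h.L_pos.le)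
    linarith [neg_le_abs (q - q₀)]
  · have hgt : B < q := not_le.mp fun hle => hq ⟨hnonneg, hle⟩
    refine h.one_le_right.trans (mul_le_mul_of_nonneg_left ?_ h.L_pos.le)
    linarith [le_abs_self (q - q₀)]

end IsLinearCrossing

end Crossing

section Drift

variable {μ : Measure Ω} {P : DataStream Ω 𝒳 𝒴} {R : Rules P} {γ : ℕ → ℝ} {α q₁ q₀ : ℝ}
  {Pi0 : ℝ → ℝ} {δ κ L D ε : ℝ} {t : ℕ} {ω : Ω}

theorem abs_ier_sub_benchmark_le (hq : threshold R γ α q₁ t ω ∈ Set.Icc 0 R.B)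
    (hD : benchDist μ R γ α q₁ Pi0 t ω ≤ D) :
    |ier μ R γ α q₁ t ω - Pi0 (threshold R γ α q₁ t ω)| ≤ D := by
  rwa [benchDist, if_pos hq] at hD

theorem benchDist_nonneg : 0 ≤ benchDist μ R γ α q₁ Pi0 t ω := by
  unfold benchDist
  split_ifs
  exacts [abs_nonneg _, le_rfl]

theorem threshold_succ_of_mem_Icc (ht : 1 ≤ t) (hq : threshold R γ α q₁ t ω ∈ Set.Icc 0 R.B) :
    threshold R γ α q₁ (t + 1) ω = threshold R γ α q₁ t ω + noise μ R γ α q₁ t ω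
      + weight R γ α q₁ t ω * (ierTrunc μ R γ α q₁ t ω - α) := by
  rw [threshold_succ_eq_add_weight_mul R γ α q₁ ω ht, reactAt_of_nonneg R γ α q₁ hq.1,
    noise_of_mem_Icc μ R γ α q₁ hq]
  ring

variable (hPi0 : IsLinearCrossing R.B α q₀ Pi0 δ κ L) (hγ : ∀ j, 0 ≤ γ j) (ht : 1 ≤ t)
include hPi0

theorem abs_ier_sub_le (hier : ier μ R γ α q₁ t ω ∈ Set.Icc (0 : ℝ) 1)
    (hD : benchDist μ R γ α q₁ Pi0 t ω ≤ D) :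
    |ier μ R γ α q₁ t ω - α| ≤ D + L * |threshold R γ α q₁ t ω - q₀| := by
  by_cases hq : threshold R γ α q₁ t ω ∈ Set.Icc 0 R.B
  · linarith [abs_ier_sub_benchmark_le hq hD, hPi0.lipschitz _ hq,
      abs_sub_le (ier μ R γ α q₁ t ω) (Pi0 (threshold R γ α q₁ t ω)) α]
  · linarith [hPi0.abs_sub_le_of_notMem hq hier, benchDist_nonneg.trans hD]

include hγ ht

theorem threshold_succ_le_of_lt (hεδ : ε ≤ δ) (hε : 0 ≤ ε) (hDε : D ≤ κ * ε / 2)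
    (hier : ier μ R γ α q₁ t ω = ierTrunc μ R γ α q₁ t ω)
    (hD : benchDist μ R γ α q₁ Pi0 t ω ≤ D) (hlt : ε < threshold R γ α q₁ t ω - q₀) :
    threshold R γ α q₁ (t + 1) ω ≤ threshold R γ α q₁ t ω + noise μ R γ α q₁ t ω
      - κ * ε / 2 * weight R γ α q₁ t ω := by
  have hweight := weight_nonneg (R := R) (α := α) (q₁ := q₁) hγ t ω
  have hq₀ := hPi0.point_mem_Ioo
  have hκε := mul_le_mul_of_nonneg_left hεδ hPi0.κ_pos.le
  have hκε_nonneg := mul_nonneg hPi0.κ_pos.le hε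
  rcases le_or_gt (threshold R γ α q₁ t ω) R.B with hle | hgt
  · have hq : threshold R γ α q₁ t ω ∈ Set.Icc 0 R.B := ⟨by linarith [hq₀.1], hle⟩
    have hbench := (abs_le.mp (abs_ier_sub_benchmark_le hq hD)).2
    have hPi := hPi0.le_sub_of_le hεδ hlt.le ⟨by linarith, hle⟩
    rw [threshold_succ_of_mem_Icc (μ := μ) ht hq, ← hier]
    linarith [mul_le_mul_of_nonneg_left
      (show ier μ R γ α q₁ t ω - α ≤ -(κ * ε / 2) by linarith) hweight]
  · rw [threshold_succ_eq_add_weight_mul R γ α q₁ ω ht, mul_sub,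
      weight_mul_reactAt_of_ge R γ α q₁ ht hgt.le,
      noise_of_notMem_Icc μ R γ α q₁ fun hq => hgt.not_ge hq.2]
    linarith [mul_le_mul_of_nonneg_left
      (show κ * ε / 2 ≤ α by linarith [hPi0.mul_le]) hweight]

theorem le_threshold_succ_of_lt (hεδ : ε ≤ δ) (hε : 0 ≤ ε) (hDε : D ≤ κ * ε / 2)
    (hier : ier μ R γ α q₁ t ω = ierTrunc μ R γ α q₁ t ω)
    (hD : benchDist μ R γ α q₁ Pi0 t ω ≤ D) (hlt : ε < q₀ - threshold R γ α q₁ t ω) :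
    threshold R γ α q₁ t ω + noise μ R γ α q₁ t ω + κ * ε / 2 * weight R γ α q₁ t ω
      ≤ threshold R γ α q₁ (t + 1) ω := by
  have hweight := weight_nonneg (R := R) (α := α) (q₁ := q₁) hγ t ω
  have hq₀ := hPi0.point_mem_Ioo
  have hκε := mul_le_mul_of_nonneg_left hεδ hPi0.κ_pos.le
  have hκε_nonneg := mul_nonneg hPi0.κ_pos.le hε
  rcases lt_or_ge (threshold R γ α q₁ t ω) 0 with hneg | hnonneg
  · rw [threshold_succ_eq_add_weight_mul R γ α q₁ ω ht, reactAt_of_neg R γ α q₁ hneg,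
      noise_of_notMem_Icc μ R γ α q₁ fun hq => hneg.not_ge hq.1]
    linarith [mul_le_mul_of_nonneg_left
      (show κ * ε / 2 ≤ 1 - α by linarith [hPi0.mul_le_one_sub]) hweight]
  · have hq : threshold R γ α q₁ t ω ∈ Set.Icc 0 R.B := ⟨hnonneg, by linarith [hq₀.2]⟩
    have hbench := (abs_le.mp (abs_ier_sub_benchmark_le hq hD)).1
    have hPi := hPi0.add_le_of_le hεδ hlt.le ⟨hnonneg, by linarith⟩
    rw [threshold_succ_of_mem_Icc (μ := μ) ht hq, ← hier]
    linarith [mul_le_mul_of_nonneg_left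
      (show κ * ε / 2 ≤ ier μ R γ α q₁ t ω - α by linarith) hweight]

omit ht in
theorem abs_threshold_sub_le_of_noise_le {t₀ T : ℕ} {b a M : ℝ} (ht₀ : 1 ≤ t₀) (htT : t₀ ≤ T)
    (hεδ : ε ≤ δ) (hε : 0 ≤ ε) (hDε : D ≤ κ * ε / 2) (hb : 0 ≤ b)
    (hier : ∀ t, t₀ ≤ t → t < T → ier μ R γ α q₁ t ω = ierTrunc μ R γ α q₁ t ω)
    (hD : ∀ t, t₀ ≤ t → t < T → benchDist μ R γ α q₁ Pi0 t ω ≤ D)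
    (hstep : ∀ t, t₀ ≤ t → t < T → γ (selNumber R γ α q₁ t ω) ≤ b)
    (hnoise : ∀ s, t₀ ≤ s → s ≤ T → |∑ t ∈ Finset.Ico s T, noise μ R γ α q₁ t ω| ≤ a)
    (hstart : |threshold R γ α q₁ t₀ ω - q₀| ≤ M)
    (hpush : M ≤ κ * ε / 2 * ∑ t ∈ Finset.Ico t₀ T, weight R γ α q₁ t ω) :
    |threshold R γ α q₁ T ω - q₀| ≤ ε + b + a := by
  have hθ : 0 ≤ κ * ε / 2 := div_nonneg (mul_nonneg hPi0.κ_pos.le hε) zero_le_two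
  have hw (t : ℕ) : 0 ≤ weight R γ α q₁ t ω := weight_nonneg hγ t ω
  have hstart := abs_le.mp (hstart.trans hpush)
  have hincr (t : ℕ) (h₀ : t₀ ≤ t) (h₁ : t < T) := abs_le.mp <|
    abs_threshold_succ_sub_le hPi0.level_mem_Icc hγ (ht₀.trans h₀) (hstep t h₀ h₁)
  have hupper : threshold R γ α q₁ T ω - q₀ ≤ ε + b + a :=
    le_of_drift (x := fun t => threshold R γ α q₁ t ω - q₀) htT hε hb hw hθ
      (fun t h₀ h₁ => by linarith [(hincr t h₀ h₁).2])
      (fun t h₀ h₁ hlt => by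
        linarith [threshold_succ_le_of_lt hPi0 hγ (ht₀.trans h₀) hεδ hε hDε (hier t h₀ h₁)
          (hD t h₀ h₁) hlt])
      (fun s h₀ h₁ => (abs_le.mp (hnoise s h₀ h₁)).2) hstart.2
  have hlower : q₀ - threshold R γ α q₁ T ω ≤ ε + b + a :=
    le_of_drift (x := fun t => q₀ - threshold R γ α q₁ t ω) (ξ := fun t => -noise μ R γ α q₁ t ω)
      htT hε hb hw hθ (fun t h₀ h₁ => by linarith [(hincr t h₀ h₁).1])
      (fun t h₀ h₁ hlt => by
        linarith [le_threshold_succ_of_lt hPi0 hγ (ht₀.trans h₀) hεδ hε hDε (hier t h₀ h₁)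
          (hD t h₀ h₁) hlt])
      (fun s h₀ h₁ => by
        rw [Finset.sum_neg_distrib]
        linarith [(abs_le.mp (hnoise s h₀ h₁)).1])
      (by linarith [hstart.1])
  exact abs_le.mpr ⟨by linarith, hupper⟩

end Drift

section Window

/-- Bounds on the step sequence `γ` over a time window `[t₀, T]`, valid as soon as the selection
numbers at the times `t₀` and `T + 1` lie in the brackets `[Jlow, Jup]`: the steps lie between `g`
and `b`, and the number of selections in `[t₀, T)` lies between `G` and `N`. -/
structure IsStepWindow (γ : ℕ → ℝ) (Jlow Jup : ℕ → ℤ) (t₀ T : ℕ) (g b G N : ℝ) : Prop where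
  one_le_start : 1 ≤ t₀
  start_le : t₀ ≤ T
  g_pos : 0 < g
  G_pos : 0 < G
  step_nonneg : ∀ j, 0 ≤ γ j
  step_le : ∀ j : ℕ, Jlow t₀ ≤ j → γ j ≤ b
  le_step : ∀ j : ℕ, 1 ≤ j → (j : ℤ) ≤ Jup (T + 1) → g ≤ γ j
  le_selections : G ≤ Jlow (T + 1) - 1 - Jup t₀
  selections_le : (Jup (T + 1) : ℝ) - Jlow t₀ ≤ N

variable {μ : Measure Ω} {P : DataStream Ω 𝒳 𝒴} {R : Rules P} {γ : ℕ → ℝ} {α q₁ q₀ : ℝ}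
  {Pi0 : ℝ → ℝ} {Jlow Jup : ℕ → ℤ} {t₀ T : ℕ} {g b G N δ κ L c D ε a : ℝ} {ω : Ω}

variable (R γ α q₁ Jlow Jup) in
/-- The event that the selection number `J(t)` lies in the bracket `[Jlow(t), Jup(t)]`. -/
def bracketEvent (t : ℕ) : Set Ω :=
  {ω | Jlow t ≤ (selNumber R γ α q₁ t ω : ℤ) ∧ (selNumber R γ α q₁ t ω : ℤ) ≤ Jup t}

theorem measureReal_compl_bracketEvent [IsProbabilityMeasure μ] {t : ℕ} (ht : 1 ≤ t) :
    μ.real (bracketEvent R γ α q₁ Jlow Jup t)ᶜ = bracketFailure μ R γ α q₁ Jlow Jup t := by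
  have hJ : Measurable (selNumber R γ α q₁ t) :=
    (measurable_selNumber R γ α q₁ ht).mono (P.history.le t) le_rfl
  have hmeas : MeasurableSet (bracketEvent R γ α q₁ Jlow Jup t) :=
    hJ (MeasurableSet.of_discrete (s := {k : ℕ | Jlow t ≤ (k : ℤ) ∧ (k : ℤ) ≤ Jup t}))
  rw [probReal_compl_eq_one_sub hmeas]
  rfl

variable (μ R γ α q₁) in
/-- The event that the noise accumulated over `[s, T)` exceeds `a` although its quadratic envelope
is at most `V`. -/
def noiseEvent (a V : ℝ) (T s : ℕ) : Set Ω :=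
  {ω | a < |∑ t ∈ Finset.Ico s T, noise μ R γ α q₁ t ω| ∧
    ∑ t ∈ Finset.Ico s T, insideStep R γ α q₁ t ω ^ 2 * selAt R γ α q₁ t ω ≤ V}

section Path

variable (hw : IsStepWindow γ Jlow Jup t₀ T g b G N)
  (hstart : ω ∈ bracketEvent R γ α q₁ Jlow Jup t₀)
  (hend : ω ∈ bracketEvent R γ α q₁ Jlow Jup (T + 1))
include hw hstart

theorem IsStepWindow.step_selNumber_le {t : ℕ} (ht : t₀ ≤ t) :
    γ (selNumber R γ α q₁ t ω) ≤ b :=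
  hw.step_le _ (hstart.1.trans (by exact_mod_cast selNumber_mono R γ α q₁ ω ht))

include hend

theorem IsStepWindow.mul_le_sum_weight :
    G * g ≤ ∑ t ∈ Finset.Ico t₀ T, weight R γ α q₁ t ω := by
  have hJstart : (selNumber R γ α q₁ t₀ ω : ℝ) ≤ Jup t₀ := by exact_mod_cast hstart.2
  have hJend : (Jlow (T + 1) : ℝ) ≤ selNumber R γ α q₁ (T + 1) ω := by exact_mod_cast hend.1
  have hlast := selAt_le_one R γ α q₁ ω (hw.one_le_start.trans hw.start_le)
  rw [cast_selNumber_succ R γ α q₁ ω (hw.one_le_start.trans hw.start_le)] at hJend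
  calc G * g ≤ (∑ t ∈ Finset.Ico t₀ T, selAt R γ α q₁ t ω) * g := by
        rw [sum_selAt R γ α q₁ ω hw.one_le_start hw.start_le]
        exact mul_le_mul_of_nonneg_right (by linarith [hw.le_selections]) hw.g_pos.le
    _ = ∑ t ∈ Finset.Ico t₀ T, g * selAt R γ α q₁ t ω := by rw [← Finset.mul_sum, mul_comm]
    _ ≤ _ := by
        refine Finset.sum_le_sum fun t ht => mul_le_mul_of_nonneg_right
          (hw.le_step _ (one_le_selNumber R γ α q₁ ω t) (le_trans ?_ hend.2))
          (selAt_nonneg R γ α q₁ ω t)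
        exact_mod_cast selNumber_mono R γ α q₁ ω ((Finset.mem_Ico.mp ht).2.le.trans T.le_succ)

theorem IsStepWindow.sum_insideStep_sq_mul_selAt_le {s : ℕ} (hs : t₀ ≤ s) (hsT : s ≤ T) :
    ∑ t ∈ Finset.Ico s T, insideStep R γ α q₁ t ω ^ 2 * selAt R γ α q₁ t ω ≤ b ^ 2 * N := by
  have hJ : (selNumber R γ α q₁ T ω : ℝ) - selNumber R γ α q₁ s ω ≤ N := by
    have hJstart : (Jlow t₀ : ℝ) ≤ selNumber R γ α q₁ t₀ ω := by exact_mod_cast hstart.1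
    have hJend : (selNumber R γ α q₁ (T + 1) ω : ℝ) ≤ Jup (T + 1) := by exact_mod_cast hend.2
    have hmono_start : (selNumber R γ α q₁ t₀ ω : ℝ) ≤ selNumber R γ α q₁ s ω := by
      exact_mod_cast selNumber_mono R γ α q₁ ω hs
    have hmono_end : (selNumber R γ α q₁ T ω : ℝ) ≤ selNumber R γ α q₁ (T + 1) ω := by
      exact_mod_cast selNumber_mono R γ α q₁ ω T.le_succ
    linarith [hw.selections_le]
  calc _ ≤ ∑ t ∈ Finset.Ico s T, b ^ 2 * selAt R γ α q₁ t ω := by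
        refine Finset.sum_le_sum fun t ht => mul_le_mul_of_nonneg_right ?_
          (selAt_nonneg R γ α q₁ ω t)
        rw [← sq_abs]
        gcongr
        exact (abs_insideStep_le R γ α q₁ ω hw.step_nonneg t).trans
          (hw.step_selNumber_le hstart (hs.trans (Finset.mem_Ico.mp ht).1))
    _ = b ^ 2 * (selNumber R γ α q₁ T ω - selNumber R γ α q₁ s ω) := by
        rw [← Finset.mul_sum, sum_selAt R γ α q₁ ω (hw.one_le_start.trans hs) hsT]
    _ ≤ b ^ 2 * N := by gcongr

theorem IsStepWindow.abs_ier_sub_add_abs_threshold_sub_le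
    (hPi0 : IsLinearCrossing R.B α q₀ Pi0 δ κ L) (hq₁ : q₁ ∈ Set.Icc 0 R.B)
    (hc : ∀ j, 1 ≤ j → γ j ≤ c) (hε : D + (R.B + c) / (G * g) ≤ κ * ε / 2) (hεδ : ε ≤ δ)
    (hier : ∀ t, 1 ≤ t → ier μ R γ α q₁ t ω ∈ Set.Icc (0 : ℝ) 1)
    (hD : ∀ t, t₀ ≤ t → t ≤ T → benchDist μ R γ α q₁ Pi0 t ω ≤ D)
    (hnoise : ∀ s, t₀ ≤ s → s ≤ T → ω ∉ noiseEvent μ R γ α q₁ a (b ^ 2 * N) T s) :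
    |ier μ R γ α q₁ T ω - α| + |threshold R γ α q₁ T ω - q₀|
      ≤ D + (L + 1) * (ε + b + a) := by
  have hGg := mul_pos hw.G_pos hw.g_pos
  have hD_nonneg : 0 ≤ D := benchDist_nonneg.trans (hD t₀ le_rfl hw.start_le)
  have hBc : 0 ≤ R.B + c := by
    linarith [R.B_pos, (hw.step_nonneg 1).trans (hc 1 le_rfl)]
  have hBc_div : 0 ≤ (R.B + c) / (G * g) := by positivity
  have hε_nonneg : 0 ≤ ε := nonneg_of_mul_nonneg_right (by linarith) hPi0.κ_pos
  have hstart_dist : |threshold R γ α q₁ t₀ ω - q₀| ≤ R.B + c := by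
    have hq₀ := hPi0.point_mem_Ioo
    have hq := threshold_mem_Icc hPi0.level_mem_Icc hq₁ hw.step_nonneg hc hw.one_le_start ω
    exact abs_le.mpr ⟨by linarith [hq.1, hq₀.2], by linarith [hq.2, hq₀.1]⟩
  have hpush : R.B + c ≤ κ * ε / 2 * ∑ t ∈ Finset.Ico t₀ T, weight R γ α q₁ t ω :=
    calc R.B + c = (R.B + c) / (G * g) * (G * g) := (div_mul_cancel₀ _ hGg.ne').symm
      _ ≤ κ * ε / 2 * (G * g) := mul_le_mul_of_nonneg_right (by linarith) hGg.le
      _ ≤ _ := mul_le_mul_of_nonneg_left (hw.mul_le_sum_weight hstart hend) (by linarith)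
  have hq : |threshold R γ α q₁ T ω - q₀| ≤ ε + b + a :=
    abs_threshold_sub_le_of_noise_le hPi0 hw.step_nonneg hw.one_le_start hw.start_le hεδ hε_nonneg
      (by linarith)
      ((hw.step_nonneg _).trans (hw.step_selNumber_le hstart le_rfl))
      (fun t h₀ _ => (ierTrunc_of_mem_Icc (hier t (hw.one_le_start.trans h₀))).symm)
      (fun t h₀ h₁ => hD t h₀ h₁.le) (fun t h₀ _ => hw.step_selNumber_le hstart h₀)
      (fun s h₀ h₁ => not_lt.mp fun hlt => hnoise s h₀ h₁
        ⟨hlt, hw.sum_insideStep_sq_mul_selAt_le hstart hend h₀ h₁⟩) hstart_dist hpush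
  have hL := hPi0.L_pos
  linarith [abs_ier_sub_le hPi0 (hier T (hw.one_le_start.trans hw.start_le))
    (hD T hw.start_le le_rfl), mul_le_mul_of_nonneg_left hq (by positivity : 0 ≤ L + 1)]

end Path

theorem one_sub_measureReal_le_of_ae_mem_union [IsProbabilityMeasure μ] {E F : Set Ω}
    (h : ∀ᵐ ω ∂μ, ω ∈ E ∪ F) : 1 - μ.real E ≤ μ.real F := by
  have hEF := measureReal_union_le (μ := μ) E F
  have huniv : μ.real (E ∪ F) = 1 :=
    (measureReal_congr (t := Set.univ) (s := E ∪ F) (eventuallyEq_univ.mpr h)).trans probReal_univ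
  linarith

variable [IsProbabilityMeasure μ]

/- `ℓ = 2 log T` in the deviation inequality leaves room for a union bound over the `≤ T` possible
last visits `s`. -/
theorem measureReal_biUnion_noiseEvent_le (hγ : ∀ j, 0 ≤ γ j) (hc : ∀ j, 1 ≤ j → γ j ≤ c)
    (ht₀ : 1 ≤ t₀) (htT : t₀ ≤ T) {V : ℝ} (hV : 0 < V) :
    μ.real (⋃ s ∈ Finset.Icc t₀ T,
      noiseEvent μ R γ α q₁ (2 * √(2 * Real.log T * V)) V T s) ≤ 2 / T := by
  have hT : (0 : ℝ) < T := by exact_mod_cast ht₀.trans htT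
  have hlog : 0 ≤ 2 * Real.log T := mul_nonneg zero_le_two (Real.log_natCast_nonneg T)
  have hexp : Real.exp (-(2 * Real.log T)) = 1 / (T : ℝ) ^ 2 := by
    rw [Real.exp_neg, two_mul, Real.exp_add, Real.exp_log hT, ← sq, one_div]
  calc _ ≤ ∑ s ∈ Finset.Icc t₀ T, μ.real (noiseEvent μ R γ α q₁ _ V T s) :=
        measureReal_biUnion_finset_le _ _
    _ ≤ ∑ s ∈ Finset.Icc t₀ T, 2 * (1 / (T : ℝ) ^ 2) := by
        refine Finset.sum_le_sum fun s hs => ?_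
        obtain ⟨h₀, h₁⟩ := Finset.mem_Icc.mp hs
        rw [← hexp]
        exact ((isSelectedNoise_noise μ R γ α q₁ hγ hc).mono_start
          (ht₀.trans h₀)).measureReal_lt_abs_sum_le_exp h₁ hV hlog
    _ ≤ T * (2 * (1 / (T : ℝ) ^ 2)) := by
        rw [Finset.sum_const, nsmul_eq_mul, Nat.card_Icc]
        gcongr
        omega
    _ = 2 / T := by field_simp

theorem IsStepWindow.one_sub_le_measureReal (hw : IsStepWindow γ Jlow Jup t₀ T g b G N)
    (hPi0 : IsLinearCrossing R.B α q₀ Pi0 δ κ L) (hq₁ : q₁ ∈ Set.Icc 0 R.B)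
    (hc : ∀ j, 1 ≤ j → γ j ≤ c) (hbN : 0 < b ^ 2 * N)
    (hε : D + (R.B + c) / (G * g) ≤ κ * ε / 2) (hεδ : ε ≤ δ) :
    1 - ∑ t ∈ Finset.Icc t₀ T, μ.real {ω | D < benchDist μ R γ α q₁ Pi0 t ω} - 2 / T
        - bracketFailure μ R γ α q₁ Jlow Jup t₀ - bracketFailure μ R γ α q₁ Jlow Jup (T + 1)
      ≤ μ.real {ω | |ier μ R γ α q₁ T ω - α| + |threshold R γ α q₁ T ω - q₀|
          ≤ D + (L + 1) * (ε + b + 2 * √(2 * Real.log T * (b ^ 2 * N)))} := by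
  set V := b ^ 2 * N
  set dist := ⋃ t ∈ Finset.Icc t₀ T, {ω | D < benchDist μ R γ α q₁ Pi0 t ω}
  set dev := ⋃ s ∈ Finset.Icc t₀ T, noiseEvent μ R γ α q₁ (2 * √(2 * Real.log T * V)) V T s
  set brStart := (bracketEvent R γ α q₁ Jlow Jup t₀)ᶜ
  set brEnd := (bracketEvent R γ α q₁ Jlow Jup (T + 1))ᶜ
  have hier : ∀ᵐ ω ∂μ, ∀ t, 1 ≤ t → ier μ R γ α q₁ t ω ∈ Set.Icc (0 : ℝ) 1 :=
    ae_all_iff.mpr fun t => Filter.eventually_imp_distrib_left.mpr (ier_mem_Icc μ R γ α q₁)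
  have hcover := one_sub_measureReal_le_of_ae_mem_union (E := dist ∪ dev ∪ brStart ∪ brEnd)
    (F := {ω | |ier μ R γ α q₁ T ω - α| + |threshold R γ α q₁ T ω - q₀|
      ≤ D + (L + 1) * (ε + b + 2 * √(2 * Real.log T * V))}) <| by
    filter_upwards [hier] with ω hω
    refine or_iff_not_imp_left.mpr fun hgood => ?_
    simp only [dist, dev, brStart, brEnd, Set.mem_union, Set.mem_iUnion, not_or, not_exists,
      Set.mem_compl_iff, not_not, Finset.mem_Icc, and_imp, Set.mem_ofPred_eq, not_lt] at hgood
    obtain ⟨⟨⟨hdist, hdev⟩, hstart⟩, hend⟩ := hgood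
    exact hw.abs_ier_sub_add_abs_threshold_sub_le hstart hend hPi0 hq₁ hc hε hεδ hω hdist hdev
  have hdist : μ.real dist ≤ _ := measureReal_biUnion_finset_le _ _
  have hdev : μ.real dev ≤ 2 / T :=
    measureReal_biUnion_noiseEvent_le hw.step_nonneg hc hw.one_le_start hw.start_le hbN
  have hbrStart : μ.real brStart = _ := measureReal_compl_bracketEvent hw.one_le_start
  have hbrEnd : μ.real brEnd = _ := measureReal_compl_bracketEvent T.succ_pos
  linarith [measureReal_union_le (μ := μ) (dist ∪ dev ∪ brStart) brEnd,
    measureReal_union_le (μ := μ) (dist ∪ dev) brStart, measureReal_union_le (μ := μ) dist dev]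

end Window

section Step

variable {c β : ℝ} {j : ℕ}

theorem step_nonneg (hc : 0 < c) (j : ℕ) : 0 ≤ step c β j :=
  mul_nonneg hc.le (Real.rpow_nonneg j.cast_nonneg _)

theorem step_le (hc : 0 < c) (hβ : 0 < β) {x : ℝ} (hx : 0 < x) (hj : x ≤ j) :
    step c β j ≤ c * x ^ (-β) :=
  mul_le_mul_of_nonneg_left (Real.rpow_le_rpow_of_nonpos hx hj (neg_nonpos.mpr hβ.le)) hc.le

theorem le_step (hc : 0 < c) (hβ : 0 < β) {x : ℝ} (hj : 1 ≤ j) (hx : j ≤ x) :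
    c * x ^ (-β) ≤ step c β j :=
  mul_le_mul_of_nonneg_left (Real.rpow_le_rpow_of_nonpos (by exact_mod_cast hj) hx
    (neg_nonpos.mpr hβ.le)) hc.le

theorem step_le_const (hc : 0 < c) (hβ : 0 < β) (hj : 1 ≤ j) : step c β j ≤ c := by
  simpa only [Real.one_rpow, mul_one] using step_le hc hβ one_pos (Nat.one_le_cast.mpr hj)

end Step

section Budget

variable {η p : ℕ → ℝ} {t₀ : ℕ}

theorem sum_le_mul_sum_inv_sq (hη : AntitoneOn η (Set.Ici 1))
    (hp : ∀ t : ℕ, 1 ≤ t → p t ≤ 6 * η t / (Real.pi ^ 2 * (t : ℝ) ^ 2)) (ht₀ : 1 ≤ t₀) (T : ℕ) :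
    ∑ t ∈ Finset.Icc t₀ T, p t
      ≤ η t₀ * (6 / Real.pi ^ 2 * ∑ t ∈ Finset.Icc t₀ T, 1 / (t : ℝ) ^ 2) := by
  rw [Finset.mul_sum, Finset.mul_sum]
  refine Finset.sum_le_sum fun t ht => ?_
  have htt₀ : t₀ ≤ t := (Finset.mem_Icc.mp ht).1
  calc p t ≤ 6 * η t / (Real.pi ^ 2 * (t : ℝ) ^ 2) := hp t (ht₀.trans htt₀)
    _ = η t * (6 / Real.pi ^ 2 * (1 / (t : ℝ) ^ 2)) := by
        rw [div_mul_div_comm, mul_one, mul_div_assoc', mul_comm 6]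
    _ ≤ _ := mul_le_mul_of_nonneg_right (hη ht₀ (ht₀.trans htt₀) htt₀) (by positivity)

theorem sum_le_start (hη_pos : ∀ t, 1 ≤ t → 0 < η t) (hη : AntitoneOn η (Set.Ici 1))
    (hp : ∀ t : ℕ, 1 ≤ t → p t ≤ 6 * η t / (Real.pi ^ 2 * (t : ℝ) ^ 2)) (ht₀ : 1 ≤ t₀) (T : ℕ) :
    ∑ t ∈ Finset.Icc t₀ T, p t ≤ η t₀ := by
  refine (sum_le_mul_sum_inv_sq hη hp ht₀ T).trans (mul_le_of_le_one_right (hη_pos t₀ ht₀).le ?_)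
  calc 6 / Real.pi ^ 2 * ∑ t ∈ Finset.Icc t₀ T, 1 / (t : ℝ) ^ 2
      ≤ 6 / Real.pi ^ 2 * (Real.pi ^ 2 / 6) :=
        mul_le_mul_of_nonneg_left
          (sum_le_hasSum _ (fun _ _ => by positivity) hasSum_zeta_two) (by positivity)
    _ = 1 := by field_simp

theorem sum_Icc_inv_sq_le (ht₀ : 1 ≤ t₀) (T : ℕ) :
    ∑ t ∈ Finset.Icc t₀ T, 1 / (t : ℝ) ^ 2 ≤ 2 / (t₀ : ℝ) := by
  obtain ⟨k, rfl⟩ := Nat.exists_eq_add_of_le' ht₀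
  have hIcc : Finset.Icc (k + 1) T = Finset.Ioo k (T + 1) := by
    ext t
    simp only [Finset.mem_Icc, Finset.mem_Ioo]
    omega
  simpa only [hIcc, one_div, Nat.cast_add_one] using sum_Ioo_inv_sq_le (α := ℝ) k (T + 1)

theorem sum_le_mul_two_div (hη_pos : ∀ t, 1 ≤ t → 0 < η t) (hη : AntitoneOn η (Set.Ici 1))
    (hp : ∀ t : ℕ, 1 ≤ t → p t ≤ 6 * η t / (Real.pi ^ 2 * (t : ℝ) ^ 2)) (ht₀ : 1 ≤ t₀) (T : ℕ) :
    ∑ t ∈ Finset.Icc t₀ T, p t ≤ η t₀ * (2 / t₀) := by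
  refine (sum_le_mul_sum_inv_sq hη hp ht₀ T).trans
    (mul_le_mul_of_nonneg_left ?_ (hη_pos t₀ ht₀).le)
  have hpi : 6 / Real.pi ^ 2 ≤ 1 := by
    rw [div_le_one (by positivity)]
    nlinarith [Real.pi_gt_three]
  exact (mul_le_of_le_one_left (Finset.sum_nonneg fun _ _ => by positivity) hpi).trans
    (sum_Icc_inv_sq_le ht₀ T)

theorem eventually_inv_le_of_log_le (hη_pos : ∀ t, 1 ≤ t → 0 < η t)
    (hη_log : ∀ᶠ T : ℕ in atTop, Real.log (1 / η T) ≤ Real.log T) :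
    ∀ᶠ T : ℕ in atTop, (T : ℝ)⁻¹ ≤ η T := by
  filter_upwards [hη_log, eventually_ge_atTop 1] with T hlog hT
  have hT_pos : (0 : ℝ) < T := by exact_mod_cast hT
  have hη_T := hη_pos T hT
  rw [Real.log_le_log_iff (by positivity) hT_pos, one_div] at hlog
  exact inv_le_of_inv_le₀ hη_T hlog

/- If `η` stays away from `0`, the tail of `∑ 1 / t²` alone is small enough. Otherwise `η (t(T))`
itself eventually beats the constant in `1 / t(T) = O(1 / T)`, and `1 / T ≤ η T`. -/
theorem eventually_mul_two_div_le (hη : AntitoneOn η (Set.Ici 1))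
    (hη_inv : ∀ᶠ T : ℕ in atTop, (T : ℝ)⁻¹ ≤ η T) {tT : ℕ → ℕ} (htT : Tendsto tT atTop atTop)
    (hO : (fun T : ℕ => (T : ℝ)) =O[atTop] (fun T => (tT T : ℝ))) :
    ∀ᶠ T : ℕ in atTop, η (tT T) * (2 / tT T) ≤ η T := by
  by_cases hbelow : ∃ e > 0, ∀ t, 1 ≤ t → e ≤ η t
  · obtain ⟨e, he, hle⟩ := hbelow
    have hlim : Tendsto (fun T => η 1 * (2 / (tT T : ℝ))) atTop (nhds (η 1 * 0)) :=
      (tendsto_const_nhds.div_atTop (tendsto_natCast_atTop_atTop.comp htT)).const_mul _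
    rw [mul_zero] at hlim
    filter_upwards [htT.eventually_ge_atTop 1, hlim.eventually_le_const he,
      eventually_ge_atTop 1] with T htT_one hsmall hT
    exact (mul_le_mul_of_nonneg_right (hη Set.self_mem_Ici htT_one htT_one)
      (by positivity)).trans (hsmall.trans (hle T hT))
  · push Not at hbelow
    obtain ⟨C, hC, hCO⟩ := hO.exists_pos
    obtain ⟨t₁, ht₁, hlt⟩ := hbelow (1 / (2 * C)) (by positivity)
    filter_upwards [htT.eventually_ge_atTop t₁, hCO.bound, hη_inv, eventually_ge_atTop 1]
      with T htT_ge hbound hinv hT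
    simp only [Real.norm_natCast] at hbound
    have hT_pos : (0 : ℝ) < T := by exact_mod_cast hT
    have htT_pos : (0 : ℝ) < tT T := by exact_mod_cast ht₁.trans htT_ge
    calc η (tT T) * (2 / tT T) ≤ 1 / (2 * C) * (2 * C / T) := by
          refine mul_le_mul ((hη ht₁ (ht₁.trans htT_ge) htT_ge).trans hlt.le) ?_
            (by positivity) (by positivity)
          rw [div_le_div_iff₀ htT_pos hT_pos]
          linarith
      _ = (T : ℝ)⁻¹ := by field_simp
      _ ≤ η T := hinv

theorem eventually_sum_le (hη_pos : ∀ t, 1 ≤ t → 0 < η t) (hη : AntitoneOn η (Set.Ici 1))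
    (hη_inv : ∀ᶠ T : ℕ in atTop, (T : ℝ)⁻¹ ≤ η T)
    (hp : ∀ t : ℕ, 1 ≤ t → p t ≤ 6 * η t / (Real.pi ^ 2 * (t : ℝ) ^ 2))
    {tT : ℕ → ℕ} (htT : Tendsto tT atTop atTop)
    (hO : (fun T : ℕ => (T : ℝ)) =O[atTop] (fun T => (tT T : ℝ))) :
    ∀ᶠ T : ℕ in atTop, ∑ t ∈ Finset.Icc (tT T) T, p t ≤ η T := by
  filter_upwards [htT.eventually_ge_atTop 1,
    eventually_mul_two_div_le hη hη_inv htT hO] with T htT_one hle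
  exact (sum_le_mul_two_div hη_pos hη hp htT_one T).trans hle

end Budget

section Rate

/-- The rate `√ℓ √G J^{-β} + G⁻¹ J^β` over a window with about `G` selections and selection numbers
of order `J`, where `ℓ = log T`: the first term is the size of the accumulated noise, the second
the bias left by the drift. -/
noncomputable def windowRate (β ℓ J G : ℝ) : ℝ :=
  √ℓ * √G * J ^ (-β) + G⁻¹ * J ^ β

/-- Asymptotically as `T → ∞`, and as long as the selection numbers lie in the brackets
`[Jlow, Jup]`, the window `[t(T), T]` has about `G(T)` selections and its selection numbers are of
order `J(T)`, up to the factors `k` and `K`. -/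
structure IsWindow (β : ℝ) (Jlow Jup : ℕ → ℤ) (tT : ℕ → ℕ) (J G : ℕ → ℝ) (k K : ℝ) : Prop where
  k_pos : 0 < k
  K_pos : 0 < K
  time_tendsto : Tendsto tT atTop atTop
  time_le : ∀ᶠ T in atTop, tT T ≤ T
  J_pos : ∀ᶠ T in atTop, 0 < J T
  one_le_G : ∀ᶠ T in atTop, 1 ≤ G T
  low : ∀ᶠ T in atTop, k * J T ≤ Jlow (tT T)
  up : ∀ᶠ T in atTop, (Jup (T + 1) : ℝ) ≤ K * J T
  gap_low : ∀ᶠ T in atTop, k * G T ≤ Jlow (T + 1) - 1 - Jup (tT T)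
  gap_up : ∀ᶠ T in atTop, (Jup (T + 1) : ℝ) - Jlow (tT T) ≤ K * G T
  tendsto : Tendsto (fun T => (G T)⁻¹ * J T ^ β) atTop (nhds 0)

variable {β c k K M κ L C₁ : ℝ}

theorem windowRate_nonneg {ℓ J G : ℝ} (hJ : 0 ≤ J) (hG : 0 ≤ G) : 0 ≤ windowRate β ℓ J G := by
  unfold windowRate
  positivity

theorem div_mul_step_eq (hK : 0 < K) {J G : ℝ} (hJ : 0 < J) :
    M / (k * G * (c * (K * J) ^ (-β))) = M * K ^ β / (k * c) * (G⁻¹ * J ^ β) := by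
  rw [Real.mul_rpow hK.le hJ.le, Real.rpow_neg hK.le, Real.rpow_neg hJ.le]
  field_simp

theorem sqrt_noise_eq (hc : 0 < c) (hk : 0 < k) (hK : 0 < K) {ℓ J G : ℝ} (hℓ : 0 ≤ ℓ)
    (hJ : 0 < J) :
    √(2 * ℓ * ((c * (k * J) ^ (-β)) ^ 2 * (K * G)))
      = c * k ^ (-β) * √(2 * K) * (√ℓ * √G * J ^ (-β)) := by
  have hstep : 0 ≤ c * k ^ (-β) * J ^ (-β) := by positivity
  calc _ = √((c * k ^ (-β) * J ^ (-β)) ^ 2 * (2 * K * (ℓ * G))) := by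
        rw [Real.mul_rpow hk.le hJ.le]
        ring_nf
    _ = c * k ^ (-β) * J ^ (-β) * (√(2 * K) * (√ℓ * √G)) := by
        rw [Real.sqrt_mul (sq_nonneg _), Real.sqrt_sq hstep, Real.sqrt_mul (by positivity),
          Real.sqrt_mul hℓ]
    _ = _ := by ring

theorem exists_le_mul_windowRate_add (hc : 0 < c) (hk : 0 < k) (hK : 0 < K) (hM : 0 < M)
    (hκ : 0 < κ) (hL : 0 < L) (hC₁ : 0 < C₁) :
    ∃ C > 0, ∀ ℓ J G d : ℝ, 1 ≤ ℓ → 0 < J → 1 ≤ G → 0 ≤ d →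
      C₁ * d + (L + 1) * (2 / κ * (C₁ * d + M / (k * G * (c * (K * J) ^ (-β))))
          + c * (k * J) ^ (-β) + 2 * √(2 * ℓ * ((c * (k * J) ^ (-β)) ^ 2 * (K * G))))
        ≤ C * (windowRate β ℓ J G + d) := by
  set bias := M * K ^ β / (k * c)
  set size := c * k ^ (-β)
  have : 0 < bias := by positivity
  have : 0 < size := by positivity
  refine ⟨C₁ + (L + 1) * (2 / κ * (C₁ + bias) + size + 2 * (size * √(2 * K))), by positivity,
    fun ℓ J G d hℓ hJ hG hd => ?_⟩
  rw [div_mul_step_eq hK hJ, sqrt_noise_eq hc hk hK (by linarith) hJ, Real.mul_rpow hk.le hJ.le,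
    ← mul_assoc c, windowRate]
  have hone : J ^ (-β) ≤ √ℓ * √G * J ^ (-β) :=
    le_mul_of_one_le_left (by positivity)
      (one_le_mul_of_one_le_of_one_le (Real.one_le_sqrt.mpr hℓ) (Real.one_le_sqrt.mpr hG))
  set x := √ℓ * √G * J ^ (-β)
  set y := G⁻¹ * J ^ β
  have hx : 0 ≤ x := by positivity
  have hy : 0 ≤ y := by positivity
  have hd_le : d ≤ x + y + d := by linarith
  have hx_le : x ≤ x + y + d := by linarith
  have hy_le : y ≤ x + y + d := by linarith
  calc _ ≤ C₁ * (x + y + d) + (L + 1) * (2 / κ * (C₁ * (x + y + d) + bias * (x + y + d))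
        + size * (x + y + d) + 2 * (size * √(2 * K) * (x + y + d))) := by
        gcongr
        exact hone.trans hx_le
    _ = _ := by ring

variable {Jlow Jup : ℕ → ℤ} {tT : ℕ → ℕ} {J G : ℕ → ℝ}

namespace IsWindow

variable (hw : IsWindow β Jlow Jup tT J G k K)
include hw

theorem eventually_windowRate_nonneg : ∀ᶠ T : ℕ in atTop,
    0 ≤ windowRate β (Real.log T) (J T) (G T) := by
  filter_upwards [hw.J_pos, hw.one_le_G] with T hJ hG
  exact windowRate_nonneg hJ.le (zero_le_one.trans hG)

theorem eventually_isStepWindow (hc : 0 < c) (hβ : 0 < β) : ∀ᶠ T in atTop,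
    IsStepWindow (step c β) Jlow Jup (tT T) T (c * (K * J T) ^ (-β)) (c * (k * J T) ^ (-β))
      (k * G T) (K * G T) := by
  have hk := hw.k_pos
  have hK := hw.K_pos
  filter_upwards [hw.time_tendsto.eventually_ge_atTop 1, hw.time_le, hw.J_pos, hw.one_le_G, hw.low,
    hw.up, hw.gap_low, hw.gap_up] with T hstart hle hJ hG hlow hup hgap_low hgap_up
  exact {
    one_le_start := hstart
    start_le := hle
    g_pos := by positivity
    G_pos := by positivity
    step_nonneg := step_nonneg hc
    step_le := fun j hj =>
      step_le hc hβ (mul_pos hk hJ) (hlow.trans (by exact_mod_cast hj))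
    le_step := fun j hj hj_up => le_step hc hβ hj (le_trans (by exact_mod_cast hj_up) hup)
    le_selections := hgap_low
    selections_le := hgap_up }

theorem tendsto_width {d : ℕ → ℝ} (hd : Tendsto d atTop (nhds 0)) :
    Tendsto (fun T => 2 / κ * (C₁ * d (tT T) + M / (k * G T * (c * (K * J T) ^ (-β))))) atTop
      (nhds 0) := by
  have hbias : Tendsto (fun T => M / (k * G T * (c * (K * J T) ^ (-β)))) atTop (nhds 0) := by
    have hlim := hw.tendsto.const_mul (M * K ^ β / (k * c))
    rw [mul_zero] at hlim
    exact hlim.congr' (hw.J_pos.mono fun T hJ => (div_mul_step_eq hw.K_pos hJ).symm)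
  simpa only [mul_zero, add_zero, Function.comp_apply] using
    (((hd.comp hw.time_tendsto).const_mul C₁).add hbias).const_mul (2 / κ)

end IsWindow

end Rate

section EventuallyAntitone

variable {d : ℕ → ℝ}

theorem exists_antitoneOn_of_eventually_succ_le (hd : ∀ᶠ t in atTop, d (t + 1) ≤ d t) :
    ∃ N, AntitoneOn d (Set.Ici N) := by
  obtain ⟨N, hN⟩ := eventually_atTop.mp hd
  exact ⟨N, antitoneOn_nat_Ici_of_succ_le hN⟩

theorem eventually_nonneg_of_eventually_succ_le (hd : ∀ᶠ t in atTop, d (t + 1) ≤ d t)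
    (hd_zero : Tendsto d atTop (nhds 0)) : ∀ᶠ t in atTop, 0 ≤ d t := by
  obtain ⟨N, hN⟩ := exists_antitoneOn_of_eventually_succ_le hd
  filter_upwards [eventually_ge_atTop N] with s hs
  refine le_of_tendsto hd_zero ?_
  filter_upwards [eventually_ge_atTop s] with t ht using hN hs (le_trans hs ht) ht

end EventuallyAntitone

section HasRate

variable {μ : Measure Ω} {P : DataStream Ω 𝒳 𝒴} {R : Rules P} {γ : ℕ → ℝ}
  {α q₁ q₀ : ℝ} {Jlow Jup : ℕ → ℤ} {tT : ℕ → ℕ} {η rate rate' : ℕ → ℝ}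

theorem hasRate_of_eventually {C₀ : ℝ} (hC₀ : 0 < C₀)
    (h : ∀ᶠ T in atTop, 1 - 3 * η T - bracketFailure μ R γ α q₁ Jlow Jup (tT T)
        - bracketFailure μ R γ α q₁ Jlow Jup (T + 1)
      ≤ μ.real {ω | |ier μ R γ α q₁ T ω - α| + |threshold R γ α q₁ T ω - q₀| ≤ C₀ * rate T}) :
    HasRate μ R γ α q₁ q₀ Jlow Jup tT η rate := by
  obtain ⟨N, hN⟩ := eventually_atTop.mp h
  exact ⟨max 1 N, C₀, le_max_left _ _, hC₀, fun T hT => hN T ((le_max_right _ _).trans hT)⟩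

variable [IsProbabilityMeasure μ]

theorem HasRate.mono (h : HasRate μ R γ α q₁ q₀ Jlow Jup tT η rate) {C : ℝ} (hC : 0 < C)
    (hle : ∀ᶠ T in atTop, rate T ≤ C * rate' T) :
    HasRate μ R γ α q₁ q₀ Jlow Jup tT η rate' := by
  obtain ⟨T₀, C₀, -, hC₀, hT₀⟩ := h
  refine hasRate_of_eventually (C₀ := C₀ * C) (by positivity) ?_
  filter_upwards [hle, eventually_ge_atTop T₀] with T hrate hT
  refine (hT₀ T hT).trans (measureReal_mono fun ω (hω : _ ≤ C₀ * rate T) => hω.trans ?_)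
  rw [mul_assoc]
  exact mul_le_mul_of_nonneg_left hrate hC₀.le

theorem HasRate.of_isBigO {ρ d : ℕ → ℝ}
    (h : HasRate μ R γ α q₁ q₀ Jlow Jup tT η (fun T => ρ T + d (tT T)))
    (hρ : ∀ᶠ T in atTop, 0 ≤ ρ T) (hd : ∀ᶠ T in atTop, 0 ≤ d T)
    (hO : (fun T => d (tT T)) =O[atTop] (fun T => ρ T + d T)) :
    HasRate μ R γ α q₁ q₀ Jlow Jup tT η (fun T => ρ T + d T) := by
  obtain ⟨C, hC, hCO⟩ := hO.exists_pos
  refine h.mono (C := 1 + C) (by positivity) ?_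
  filter_upwards [hρ, hd, hCO.bound] with T hρT hdT hbound
  rw [Real.norm_of_nonneg (add_nonneg hρT hdT)] at hbound
  linarith [(Real.le_norm_self _).trans hbound]

/- There are at most `T` selections by time `T`, so a lower bracket of slope `r > 1` always fails at
time `T + 1` and the probability bound is trivial. -/
theorem hasRate_of_one_lt {r : ℝ} (hη : ∀ t, 1 ≤ t → 0 < η t) (hr : 1 < r)
    (hlow : ∀ᶠ T : ℕ in atTop, r * (T : ℝ) ≤ Jlow T) :
    HasRate μ R γ α q₁ q₀ Jlow Jup tT η rate := by
  refine hasRate_of_eventually one_pos ?_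
  filter_upwards [(tendsto_add_atTop_nat 1).eventually hlow, eventually_ge_atTop 1]
    with T hlow_succ hT
  have hempty : bracketEvent R γ α q₁ Jlow Jup (T + 1) = ∅ := by
    refine Set.eq_empty_of_forall_notMem fun ω hω => ?_
    have hJ_le : (selNumber R γ α q₁ (T + 1) ω : ℝ) ≤ (T + 1 : ℕ) := by
      exact_mod_cast selNumber_le R γ α q₁ ω (Nat.le_add_left 1 T)
    have hle_J : (Jlow (T + 1) : ℝ) ≤ selNumber R γ α q₁ (T + 1) ω := by exact_mod_cast hω.1
    have hlt : ((T + 1 : ℕ) : ℝ) < r * (T + 1 : ℕ) := lt_mul_of_one_lt_left (by positivity) hr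
    linarith
  have hfail : bracketFailure μ R γ α q₁ Jlow Jup (T + 1) = 1 := by
    rw [← measureReal_compl_bracketEvent T.succ_pos, hempty, Set.compl_empty, probReal_univ]
  have hfail_nonneg : 0 ≤ bracketFailure μ R γ α q₁ Jlow Jup (tT T) :=
    sub_nonneg.mpr measureReal_le_one
  linarith [hη T hT, measureReal_nonneg (μ := μ) (s := {ω | |ier μ R γ α q₁ T ω - α|
    + |threshold R γ α q₁ T ω - q₀| ≤ 1 * rate T})]

theorem IsWindow.hasRate {c β k K C₁ δ κ L : ℝ} {Pi0 : ℝ → ℝ} {d : ℕ → ℝ} {J G : ℕ → ℝ}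
    (hw : IsWindow β Jlow Jup tT J G k K) (hc : 0 < c) (hβ : 0 < β) (hq₁ : q₁ ∈ Set.Icc 0 R.B)
    (hPi0 : IsLinearCrossing R.B α q₀ Pi0 δ κ L) (hC₁ : 0 < C₁)
    (hd_zero : Tendsto d atTop (nhds 0)) (hd : ∀ᶠ t in atTop, d (t + 1) ≤ d t)
    (hsum : ∀ᶠ T in atTop, ∑ t ∈ Finset.Icc (tT T) T,
      μ.real {ω | C₁ * d t < benchDist μ R (step c β) α q₁ Pi0 t ω} ≤ η T)
    (hη_inv : ∀ᶠ T : ℕ in atTop, (T : ℝ)⁻¹ ≤ η T) :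
    HasRate μ R (step c β) α q₁ q₀ Jlow Jup tT η
      (fun T => windowRate β (Real.log T) (J T) (G T) + d (tT T)) := by
  have hκ := hPi0.κ_pos
  have hM : 0 < R.B + c := add_pos R.B_pos hc
  have hlog : Tendsto (fun T : ℕ => Real.log T) atTop atTop :=
    Real.tendsto_log_atTop.comp tendsto_natCast_atTop_atTop
  obtain ⟨N, hN⟩ := exists_antitoneOn_of_eventually_succ_le hd
  obtain ⟨C, hC, hrate⟩ := exists_le_mul_windowRate_add (β := β) hc hw.k_pos hw.K_pos hM hκ
    hPi0.L_pos hC₁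
  refine hasRate_of_eventually hC ?_
  filter_upwards [hw.eventually_isStepWindow hc hβ, hw.J_pos, hw.one_le_G,
    hw.time_tendsto.eventually_ge_atTop N, hlog.eventually_ge_atTop 1,
    hw.time_tendsto.eventually (eventually_nonneg_of_eventually_succ_le hd hd_zero),
    (hw.tendsto_width (c := c) (κ := κ) (M := R.B + c) (C₁ := C₁) hd_zero).eventually_le_const
      hPi0.δ_pos, hsum, hη_inv] with T hstep hJ hG hNT hlogT hdT hwidth hsumT hinvT
  have hvar : 0 < (c * (k * J T) ^ (-β)) ^ 2 * (K * G T) := by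
    have := hw.k_pos
    have := hw.K_pos
    positivity
  have hsum_window : ∑ t ∈ Finset.Icc (tT T) T,
      μ.real {ω | C₁ * d (tT T) < benchDist μ R (step c β) α q₁ Pi0 t ω} ≤ η T := by
    refine (Finset.sum_le_sum fun t ht => measureReal_mono fun ω hω => ?_).trans hsumT
    have htT : tT T ≤ t := (Finset.mem_Icc.mp ht).1
    exact (mul_le_mul_of_nonneg_left (hN hNT (le_trans hNT htT) htT) hC₁.le).trans_lt hω
  have hprob := hstep.one_sub_le_measureReal (μ := μ) hPi0 hq₁ (fun _ => step_le_const hc hβ) hvar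
    (D := C₁ * d (tT T)) (le_of_eq (by field_simp)) hwidth
  have htwo : 2 / (T : ℝ) ≤ 2 * η T := by
    rw [div_eq_mul_inv]
    exact mul_le_mul_of_nonneg_left hinvT zero_le_two
  refine le_trans (by linarith) (hprob.trans (measureReal_mono fun ω hω => ?_))
  exact le_trans hω (hrate _ _ _ _ hlogT hJ hG hdT)

end HasRate

section Asymptotic

variable {u v : ℕ → ℝ} {a : ℝ}

theorem eventually_mul_le_of_isEquivalent (h : u ~[atTop] v) (hv : ∀ᶠ T in atTop, 0 ≤ v T)
    (ha : a < 1) : ∀ᶠ T in atTop, a * v T ≤ u T := by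
  filter_upwards [h.isLittleO.def (sub_pos.mpr ha), hv] with T hbound hvT
  rw [Real.norm_eq_abs, Pi.sub_apply, Real.norm_of_nonneg hvT] at hbound
  linarith [(abs_le.mp hbound).1]

theorem eventually_le_mul_of_isEquivalent (h : u ~[atTop] v) (hv : ∀ᶠ T in atTop, 0 ≤ v T)
    (ha : 1 < a) : ∀ᶠ T in atTop, u T ≤ a * v T := by
  filter_upwards [h.isLittleO.def (sub_pos.mpr ha), hv] with T hbound hvT
  rw [Real.norm_eq_abs, Pi.sub_apply, Real.norm_of_nonneg hvT] at hbound
  linarith [(abs_le.mp hbound).2]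

end Asymptotic

section Linear

variable {β r : ℝ} {Jlow Jup : ℕ → ℤ} {tT : ℕ → ℕ}

theorem eventually_mul_le_linear (hr : 0 < r)
    (hlow : (fun T : ℕ => (Jlow T : ℝ)) ~[atTop] (fun T : ℕ => r * (T : ℝ))) {s : ℝ} (hs : s < r) :
    ∀ᶠ T : ℕ in atTop, s * (T : ℝ) ≤ Jlow T := by
  filter_upwards [eventually_mul_le_of_isEquivalent hlow
    (.of_forall fun T => by positivity) ((div_lt_one hr).mpr hs)] with T hT
  rwa [← mul_assoc, div_mul_cancel₀ _ hr.ne'] at hT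

theorem rhoLinear_eq_windowRate {T : ℕ} (hT : 1 ≤ T) :
    rhoLinear β T = windowRate β (Real.log T) T T := by
  have hT_pos : (0 : ℝ) < T := by exact_mod_cast hT
  rw [windowRate, rhoLinear, Real.sqrt_eq_rpow (T : ℝ), mul_assoc, ← Real.rpow_add hT_pos,
    ← sub_eq_add_neg, ← Real.rpow_neg_one, ← Real.rpow_add hT_pos, neg_add_eq_sub]

theorem tendsto_inv_mul_rpow (hβ : β < 1) :
    Tendsto (fun T : ℕ => (T : ℝ)⁻¹ * (T : ℝ) ^ β) atTop (nhds 0) := by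
  have hlim : Tendsto (fun T : ℕ => (T : ℝ) ^ (-(1 - β))) atTop (nhds 0) :=
    (tendsto_rpow_neg_atTop (sub_pos.mpr hβ)).comp tendsto_natCast_atTop_atTop
  refine hlim.congr' ?_
  filter_upwards [eventually_ge_atTop 1] with T hT
  rw [neg_sub, sub_eq_neg_add, Real.rpow_add (by exact_mod_cast hT), Real.rpow_neg_one]

variable (hr : 0 < r) (htT : ∀ T : ℕ, tT T = ⌊r * (T : ℝ) / 2⌋₊)
include hr htT

theorem eventually_le_halfTime : ∀ᶠ T : ℕ in atTop, r * (T : ℝ) / 4 ≤ tT T := by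
  filter_upwards [tendsto_natCast_atTop_atTop.eventually_ge_atTop (4 / r)] with T hT
  rw [div_le_iff₀ hr] at hT
  rw [htT]
  linarith [Nat.lt_floor_add_one (r * (T : ℝ) / 2)]

theorem tendsto_halfTime : Tendsto tT atTop atTop := by
  rw [← tendsto_natCast_atTop_iff (R := ℝ)]
  exact tendsto_atTop_mono' atTop (eventually_le_halfTime hr htT)
    ((tendsto_natCast_atTop_atTop.const_mul_atTop hr).atTop_div_const (by norm_num))

theorem isBigO_halfTime : (fun T : ℕ => (T : ℝ)) =O[atTop] (fun T => (tT T : ℝ)) := by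
  refine IsBigO.of_bound (4 / r) ?_
  filter_upwards [eventually_le_halfTime hr htT] with T hT
  rw [Real.norm_natCast, Real.norm_natCast]
  calc (T : ℝ) = 4 / r * (r * T / 4) := by field_simp
    _ ≤ _ := mul_le_mul_of_nonneg_left hT (by positivity)

variable (hlow : (fun T : ℕ => (Jlow T : ℝ)) ~[atTop] (fun T : ℕ => r * (T : ℝ)))
  (hup : ∀ T, 1 ≤ T → Jup T = (T : ℤ))
include hlow

theorem eventually_mul_le_low_halfTime :
    ∀ᶠ T : ℕ in atTop, r ^ 2 / 8 * (T : ℝ) ≤ Jlow (tT T) := by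
  filter_upwards [(tendsto_halfTime hr htT).eventually
    (eventually_mul_le_linear hr hlow (half_lt_self hr)), eventually_le_halfTime hr htT]
    with T hlowT hfloor
  calc r ^ 2 / 8 * (T : ℝ) = r / 2 * (r * T / 4) := by ring
    _ ≤ r / 2 * tT T := mul_le_mul_of_nonneg_left hfloor (by positivity)
    _ ≤ _ := hlowT

include hup

theorem eventually_mul_le_gap_halfTime (hr_one : r ≤ 1) :
    ∀ᶠ T : ℕ in atTop, r ^ 2 / 8 * (T : ℝ) ≤ Jlow (T + 1) - 1 - Jup (tT T) := by
  filter_upwards [(tendsto_add_atTop_nat 1).eventually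
      (eventually_mul_le_linear hr hlow (show 3 / 4 * r < r by linarith)),
    (tendsto_halfTime hr htT).eventually_ge_atTop 1,
    tendsto_natCast_atTop_atTop.eventually_ge_atTop (8 / r)] with T hlowT htT_one hT
  have hfloor : (tT T : ℝ) ≤ r * T / 2 := by
    rw [htT]
    exact Nat.floor_le (by positivity)
  have hsq : r ^ 2 * (T : ℝ) ≤ r * T :=
    mul_le_mul_of_nonneg_right (pow_le_of_le_one hr.le hr_one two_ne_zero) T.cast_nonneg
  rw [div_le_iff₀ hr] at hT
  rw [hup _ htT_one, Int.cast_natCast]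
  push_cast at hlowT
  linarith

theorem isWindow_linear (hβ : β < 1) (hr_one : r ≤ 1) :
    IsWindow β Jlow Jup tT (fun T => (T : ℝ)) (fun T => (T : ℝ)) (r ^ 2 / 8) 2 := by
  have hup_succ (T : ℕ) : (Jup (T + 1) : ℝ) = T + 1 := by
    rw [hup _ T.succ_pos, Int.cast_natCast, Nat.cast_succ]
  have hlow_half := eventually_mul_le_low_halfTime hr htT hlow
  have hone : ∀ᶠ T : ℕ in atTop, (1 : ℝ) ≤ T :=
    tendsto_natCast_atTop_atTop.eventually_ge_atTop 1
  exact {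
    k_pos := by positivity
    K_pos := two_pos
    time_tendsto := tendsto_halfTime hr htT
    time_le := .of_forall fun T => by
      rw [htT]
      refine Nat.floor_le_of_le ?_
      linarith [mul_le_of_le_one_left T.cast_nonneg hr_one, (T.cast_nonneg : (0 : ℝ) ≤ T)]
    J_pos := hone.mono fun T hT => zero_lt_one.trans_le hT
    one_le_G := hone
    low := hlow_half
    up := hone.mono fun T hT => by linarith [hup_succ T]
    gap_low := eventually_mul_le_gap_halfTime hr htT hlow hup hr_one
    gap_up := by
      filter_upwards [hlow_half, hone] with T hlowT hT
      have : 0 ≤ r ^ 2 / 8 * (T : ℝ) := by positivity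
      linarith [hup_succ T]
    tendsto := tendsto_inv_mul_rpow hβ }

end Linear

namespace IsConcRegime

variable {β : ℝ} {Jlow Jup : ℕ → ℤ} {tT : ℕ → ℕ} (h : IsConcRegime β Jlow Jup tT)
include h

theorem exists_monotoneOn_up : ∃ N, MonotoneOn (fun t => (Jup t : ℝ)) (Set.Ici N) := by
  obtain ⟨N, hN⟩ := eventually_atTop.mp h.mono_up
  exact ⟨N, Int.cast_mono.comp_monotoneOn (monotoneOn_nat_Ici_of_le_succ hN)⟩

theorem tendsto_up : Tendsto (fun T => (Jup T : ℝ)) atTop atTop := by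
  obtain ⟨N, hN⟩ := h.exists_monotoneOn_up
  refine tendsto_atTop_mono' atTop ?_ h.gap_tendsto
  filter_upwards [h.gap_lt_up.def one_pos, eventually_ge_atTop N,
    h.gap_tendsto.eventually_gt_atTop (-(Jup N : ℝ)), h.gap_tendsto.eventually_ge_atTop 0]
    with T hbound hNT hgap_gt hgap_nonneg
  rw [Real.norm_of_nonneg hgap_nonneg, one_mul, Real.norm_eq_abs] at hbound
  have hmono : (Jup N : ℝ) ≤ Jup T := hN Set.self_mem_Ici hNT hNT
  exact (le_abs.mp hbound).resolve_right fun hneg => by linarith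

theorem eventually_half_mul_up_le : ∀ᶠ T in atTop, 1 / 2 * (Jup T : ℝ) ≤ Jlow (tT T) := by
  obtain ⟨N, hN⟩ := h.exists_monotoneOn_up
  filter_upwards [eventually_mul_le_of_isEquivalent h.low_up
    ((tendsto_add_atTop_nat 1).eventually (h.tendsto_up.eventually_ge_atTop 0)) one_half_lt_one,
    eventually_ge_atTop N] with T hle hNT
  have hmono : (Jup T : ℝ) ≤ Jup (T + 1) := hN hNT (le_trans hNT T.le_succ) T.le_succ
  linarith

theorem eventually_up_succ_le : ∀ᶠ T in atTop, (Jup (T + 1) : ℝ) ≤ 2 * Jup T := by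
  obtain ⟨N, hN⟩ := h.exists_monotoneOn_up
  filter_upwards [eventually_le_mul_of_isEquivalent h.up_up
    (h.time_tendsto.eventually (h.tendsto_up.eventually_ge_atTop 0)) one_lt_two,
    h.time_tendsto.eventually_ge_atTop N, h.time_lt] with T hle hNT hlt
  have hmono : (Jup (tT T) : ℝ) ≤ Jup T := hN hNT (le_trans hNT hlt.le) hlt.le
  linarith

theorem isWindow : IsWindow β Jlow Jup tT (fun T => (Jup T : ℝ)) (gap Jlow Jup tT) (1 / 2) 2 where
  k_pos := one_half_pos
  K_pos := two_pos
  time_tendsto := h.time_tendsto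
  time_le := h.time_lt.mono fun _ => le_of_lt
  J_pos := h.tendsto_up.eventually_gt_atTop 0
  one_le_G := h.gap_tendsto.eventually_ge_atTop 1
  low := h.eventually_half_mul_up_le
  up := h.eventually_up_succ_le
  gap_low := by
    filter_upwards [h.gap_tendsto.eventually_ge_atTop 2] with T hgap
    rw [gap] at hgap ⊢
    push_cast at hgap ⊢
    linarith
  gap_up := eventually_le_mul_of_isEquivalent h.gap_equiv.symm
    (h.gap_tendsto.eventually_ge_atTop 0) one_lt_two
  tendsto := h.pow_lt_gap.tendsto_div_nhds_zero.congr fun T => by rw [div_eq_inv_mul]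

end IsConcRegime

end OnlineSCI

theorem mainTheorem3_general {Ω 𝒳 𝒴 : Type*} [MeasurableSpace Ω] [MeasurableSpace 𝒳]
    [MeasurableSpace 𝒴] (μ : Measure Ω) [IsProbabilityMeasure μ]
    (P : OnlineSCI.DataStream Ω 𝒳 𝒴) (R : OnlineSCI.Rules P)
    (α c β q₁ q₀ : ℝ) (hc : 0 < c) (hβ : β ∈ Set.Ioo (0 : ℝ) 1) (hq₁ : q₁ ∈ Set.Icc 0 R.B)
    (Pi0 : ℝ → ℝ) {δ κ L : ℝ} (hPi0 : OnlineSCI.IsLinearCrossing R.B α q₀ Pi0 δ κ L)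
    (Dbar η : ℕ → ℝ) (C₁ : ℝ) (hC₁ : 0 < C₁)
    (hDbar_tendsto : Tendsto Dbar atTop (nhds 0))
    (hDbar_anti : ∀ᶠ t in atTop, Dbar (t + 1) ≤ Dbar t)
    (hη_pos : ∀ t, 1 ≤ t → 0 < η t)
    (hη_anti : ∀ t, 1 ≤ t → η (t + 1) ≤ η t)
    (hη_log : ∀ᶠ T : ℕ in atTop, Real.log (1 / η T) ≤ Real.log T)
    (hD : ∀ t : ℕ, 1 ≤ t →
      μ.real {ω | C₁ * Dbar t < OnlineSCI.benchDist μ R (OnlineSCI.step c β) α q₁ Pi0 t ω}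
        ≤ 6 * η t / (Real.pi ^ 2 * (t : ℝ) ^ 2)) :
    (∀ (r : ℝ) (Jlow Jup : ℕ → ℤ) (tT : ℕ → ℕ), 0 < r →
      (fun T : ℕ => (Jlow T : ℝ)) ~[atTop] (fun T : ℕ => r * (T : ℝ)) →
      (∀ T, 1 ≤ T → Jup T = (T : ℤ)) →
      (∀ T : ℕ, tT T = ⌊r * (T : ℝ) / 2⌋₊) →
      OnlineSCI.HasRate μ R (OnlineSCI.step c β) α q₁ q₀ Jlow Jup tT η
        (fun T => OnlineSCI.rhoLinear β T + Dbar (tT T)) ∧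
      ((fun T => Dbar (tT T)) =O[atTop] (fun T => OnlineSCI.rhoLinear β T + Dbar T) →
        OnlineSCI.HasRate μ R (OnlineSCI.step c β) α q₁ q₀ Jlow Jup tT η
          (fun T => OnlineSCI.rhoLinear β T + Dbar T))) ∧
    (∀ (Jlow Jup : ℕ → ℤ) (tT : ℕ → ℕ), OnlineSCI.IsConcRegime β Jlow Jup tT →
      OnlineSCI.HasRate μ R (OnlineSCI.step c β) α q₁ q₀ Jlow Jup tT (fun T => η (tT T))
        (fun T => OnlineSCI.rhoConc β Jlow Jup tT T + Dbar (tT T)) ∧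
      ((fun T : ℕ => (T : ℝ)) =O[atTop] (fun T => (tT T : ℝ)) →
        OnlineSCI.HasRate μ R (OnlineSCI.step c β) α q₁ q₀ Jlow Jup tT η
          (fun T => OnlineSCI.rhoConc β Jlow Jup tT T + Dbar (tT T)) ∧
        ((fun T => Dbar (tT T)) =O[atTop]
            (fun T => OnlineSCI.rhoConc β Jlow Jup tT T + Dbar T) →
          OnlineSCI.HasRate μ R (OnlineSCI.step c β) α q₁ q₀ Jlow Jup tT η
            (fun T => OnlineSCI.rhoConc β Jlow Jup tT T + Dbar T)))) := by
  open OnlineSCI in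
  have hη : AntitoneOn η (Set.Ici 1) := antitoneOn_nat_Ici_of_succ_le hη_anti
  have hη_inv := eventually_inv_le_of_log_le hη_pos hη_log
  have hDbar_nonneg := eventually_nonneg_of_eventually_succ_le hDbar_anti hDbar_tendsto
  have hrate {Jlow Jup tT J G k K} (hw : IsWindow β Jlow Jup tT J G k K) {η' : ℕ → ℝ} :=
    hw.hasRate (μ := μ) (η := η') hc hβ.1 hq₁ hPi0 hC₁ hDbar_tendsto hDbar_anti
  have hrate_of_isBigO {Jlow Jup tT J G k K} (hw : IsWindow β Jlow Jup tT J G k K) hO :=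
    hrate hw (eventually_sum_le hη_pos hη hη_inv hD hw.time_tendsto hO) hη_inv
  refine ⟨fun r Jlow Jup tT hr hlow hup htT => ?_, fun Jlow Jup tT hreg => ⟨?_, fun hO => ?_⟩⟩
  · rcases lt_or_ge 1 r with hr_gt | hr_le
    · obtain ⟨s, hs, hsr⟩ := exists_between hr_gt
      have hbracket := eventually_mul_le_linear hr hlow hsr
      exact ⟨hasRate_of_one_lt hη_pos hs hbracket, fun _ => hasRate_of_one_lt hη_pos hs hbracket⟩
    have hw := isWindow_linear hr htT hlow hup hβ.2 hr_le
    have hlinear := (hrate_of_isBigO hw (isBigO_halfTime hr htT)).mono one_pos <|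
      (eventually_ge_atTop 1).mono fun T hT => by rw [one_mul, ← rhoLinear_eq_windowRate hT]
    refine ⟨hlinear, hlinear.of_isBigO (.of_forall fun T => ?_) hDbar_nonneg⟩
    unfold rhoLinear
    positivity
  · have hw := hreg.isWindow
    refine hrate hw ?_ ?_
    · filter_upwards [hw.time_tendsto.eventually_ge_atTop 1] with T hT
      exact sum_le_start hη_pos hη hD hT T
    · filter_upwards [hη_inv, hw.time_tendsto.eventually_ge_atTop 1, hw.time_le] with T hinv hT hle
      exact hinv.trans (hη hT (le_trans hT hle) hle)
  · have hconc := hrate_of_isBigO hreg.isWindow hO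
    exact ⟨hconc, hconc.of_isBigO hreg.isWindow.eventually_windowRate_nonneg hDbar_nonneg⟩

theorem mainTheorem3 {Ω 𝒳 𝒴 : Type*} [MeasurableSpace Ω] [MeasurableSpace 𝒳] [MeasurableSpace 𝒴]
    (μ : Measure Ω) [IsProbabilityMeasure μ]
    (P : OnlineSCI.DataStream Ω 𝒳 𝒴) (R : OnlineSCI.Rules P)
    (α c β q₁ q₀ : ℝ) (hα : α ∈ Set.Ioo (0 : ℝ) 1) (hc : 0 < c)
    (hβ : β ∈ Set.Ioo (1 / 2 : ℝ) 1) (hq₁ : q₁ ∈ Set.Icc 0 R.B)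
    (Pi0 : ℝ → ℝ) (hPi0 : OnlineSCI.IsBenchmark R.B α q₀ Pi0)
    (Dbar η : ℕ → ℝ) (C₁ : ℝ) (hC₁ : 0 < C₁)
    (hDbar_tendsto : Tendsto Dbar atTop (nhds 0))
    (hDbar_anti : ∀ᶠ t in atTop, Dbar (t + 1) ≤ Dbar t)
    (hη : ∀ t, 1 ≤ t → 0 < η t ∧ η t ≤ 1)
    (hη_anti : ∀ t, 1 ≤ t → η (t + 1) ≤ η t)
    (hη_log : ∀ᶠ T : ℕ in atTop, Real.log (1 / η T) ≤ Real.log T)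
    (hD : ∀ t : ℕ, 1 ≤ t →
      μ.real {ω | C₁ * Dbar t < OnlineSCI.benchDist μ R (OnlineSCI.step c β) α q₁ Pi0 t ω}
        ≤ 6 * η t / (Real.pi ^ 2 * (t : ℝ) ^ 2)) :
    -- linear lower bracket
    (∀ (r : ℝ) (Jlow Jup : ℕ → ℤ) (tT : ℕ → ℕ), 0 < r →
      (fun T : ℕ => (Jlow T : ℝ)) ~[atTop] (fun T : ℕ => r * (T : ℝ)) →
      (∀ T, 1 ≤ T → Jup T = (T : ℤ)) →
      (∀ T : ℕ, tT T = ⌊r * (T : ℝ) / 2⌋₊) →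
      OnlineSCI.HasRate μ R (OnlineSCI.step c β) α q₁ q₀ Jlow Jup tT η
        (fun T => OnlineSCI.rhoLinear β T + Dbar (tT T)) ∧
      ((fun T => Dbar (tT T)) =O[atTop] (fun T => OnlineSCI.rhoLinear β T + Dbar T) →
        OnlineSCI.HasRate μ R (OnlineSCI.step c β) α q₁ q₀ Jlow Jup tT η
          (fun T => OnlineSCI.rhoLinear β T + Dbar T))) ∧
    -- concentration regime
    (∀ (Jlow Jup : ℕ → ℤ) (tT : ℕ → ℕ), OnlineSCI.IsConcRegime β Jlow Jup tT →
      OnlineSCI.HasRate μ R (OnlineSCI.step c β) α q₁ q₀ Jlow Jup tT (fun T => η (tT T))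
        (fun T => OnlineSCI.rhoConc β Jlow Jup tT T + Dbar (tT T)) ∧
      ((fun T : ℕ => (T : ℝ)) =O[atTop] (fun T => (tT T : ℝ)) →
        OnlineSCI.HasRate μ R (OnlineSCI.step c β) α q₁ q₀ Jlow Jup tT η
          (fun T => OnlineSCI.rhoConc β Jlow Jup tT T + Dbar (tT T)) ∧
        ((fun T => Dbar (tT T)) =O[atTop]
            (fun T => OnlineSCI.rhoConc β Jlow Jup tT T + Dbar T) →
          OnlineSCI.HasRate μ R (OnlineSCI.step c β) α q₁ q₀ Jlow Jup tT η
            (fun T => OnlineSCI.rhoConc β Jlow Jup tT T + Dbar T)))) := by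
  obtain ⟨δ, κ, L, hcrossing⟩ := hPi0.exists_isLinearCrossing
  exact mainTheorem3_general μ P R α c β q₁ q₀ hc ⟨one_half_pos.trans hβ.1, hβ.2⟩ hq₁ Pi0 hcrossing
    Dbar η C₁ hC₁ hDbar_tendsto hDbar_anti (fun t ht => (hη t ht).1) hη_anti hη_log hD
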